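/- **Setting.** Let $\overline{\mathbb Q}$ be an algebraic closure of $\mathbb Q$, $\mathbb G=(\overline{\mathbb Q}^\times)^2$, and $\chi^a(\gamma)=\gamma_1^{a_1}\gamma_2^{a_2}$ for $a\in\mathbb Z^2$, $\gamma\in\mathbb G$. Let $C=\{x_0+x_1+x_2=0\}\subset\mathbb P^2(\overline{\mathbb Q})$, let $\omega\in\mathbb G$ act on $\mathbb P^2(\overline{\mathbb Q})$ by $\omega[x_0:x_1:x_2]=[x_0:\omega_1x_1:\omega_2x_2]$, and let $\mathrm h$ be the canonical (absolute logarithmic) height on $\mathbb P^2(\overline{\mathbb Q})$. For an algebraic subset $V\subset\mathbb G$, a sequence $(\gamma_\ell)_{\ell\ge1}$ in $V$ is *strict in $V$* if for every algebraic subgroup $H\subset\mathbb G$ not containing $V$ there is $\ell_0$ with $\gamma_\ell\notin H$ for all $\ell\ge\ell_0$. For a primitive vector $a\in\mathbb Z^2$ and $e\ge1$ put $V_{a,e}=\{\gamma\in\mathbb G:\Phi_e(\chi^a(\gamma))=0\}$, where $\Phi_e$ is the $e$-th cyclotomic polynomial, and $$\mathbb D_{a,e}=\bigcup_{j\in(\mathbb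 Z/e\mathbb Z)^\times}\Big\{u\in(\mathbb R/2\pi\mathbb Z)^2 : a_1u_1+a_2u_2=\tfrac{2\pi j}{e}\Big\},$$ a union of $\varphi(e)$ parallel segments; let $\tau_{a,e}$ be the probability measure on $\mathbb D_{a,e}$ induced by the Euclidean length on these segments, and $$\eta_{a,e}=\int_{\mathbb D_{a,e}}\log\max\big(|\mathrm e^{\mathrm iu_2}-\mathrm e^{\mathrm iu_1}|,|\mathrm e^{\mathrm iu_2}-1|,|\mathrm e^{\mathrm iu_1}-1|\big)\,d\tau_{a,e}(u).$$ **Theorem.** Let $a\in\mathbb Z^2$ be primitive and $e\ge1$. The integrand above is $\tau_{a,e}$-integrable, and for every strict sequence $(\omega_\ell)_{\ell\ge1}$ in $V_{a,e}$ of nontrivial torsion points (torsion points of $\mathbb G$ different from $(1,1)$), each intersection $C\cap\omega_\ell C$ consists of a single point of $\mathbb P^2(\overline{\mathbb Q})$, and $$\lim_{\ell\to+\infty}\mathrm h(C\cap\omega_\ell C)=\eta_{a,e}.$$ Moreover, $\eta_{a,1}=0$ for $a\in\{(0,1),(1,0),(1,-1)\}$, and $$\eta_{a,1}=\frac{3\sqrt3}{4\pi}\,L(\chi_{-3},2)\qquad\text{for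 } a\in\{(2,-1),(1,1),(1,-2)\},$$ where $\chi_{-3}$ is the odd Dirichlet character modulo $3$. -/

import Mathlib

open Filter Topology MeasureTheory
open scoped Real

noncomputable section

namespace TorusHeight

/-- The fixed algebraic closure of the rationals. -/
abbrev QBar : Type := AlgebraicClosure ℚ

theorem isIntegral_qBar (y : QBar) : IsIntegral ℚ y := by
  have h := (AlgebraicClosure.isAlgebraic ℚ).isAlgebraic y
  convert h.isIntegral
  · rfl
  · exact Subsingleton.elim _ _

/-- The group of algebraic points of the split torus of dimension `n`. -/
abbrev Torus (n : ℕ) : Type := Fin n → QBarˣ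

/-- Algebraic (Zariski closed) subsets of the torus. Since the coordinates are invertible,
polynomials and Laurent polynomials have the same zero sets. -/
def IsAlgebraicSet {n : ℕ} (V : Set (Torus n)) : Prop :=
  ∃ I : Set (MvPolynomial (Fin n) QBar),
    V = {γ | ∀ p ∈ I, MvPolynomial.eval (fun i => (γ i : QBar)) p = 0}

/-- A sequence in `V` is strict in `V` if it eventually avoids every algebraic subgroup of the
torus that does not contain `V`. -/
def IsStrictIn {n : ℕ} (V : Set (Torus n)) (γ : ℕ → Torus n) : Prop :=
  (∀ l, γ l ∈ V) ∧
    ∀ H : Subgroup (Torus n), IsAlgebraicSet (H : Set (Torus n)) → ¬ V ⊆ (H : Set (Torus n)) →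
      ∀ᶠ l in atTop, γ l ∉ H

/-- The character `γ ↦ ∏ i, γ i ^ a i` of the torus. -/
def character {n : ℕ} (a : Fin n → ℤ) (γ : Torus n) : QBarˣ := ∏ i, γ i ^ a i

/-- The zero set of `Φ_e (χ^a)` in the torus of dimension two. -/
def torsionCurve (a : Fin 2 → ℤ) (e : ℕ) : Set (Torus 2) :=
  {γ | (Polynomial.cyclotomic e QBar).eval (character a γ : QBar) = 0}

/-- The projective space of dimension `n` over the algebraic numbers. -/
abbrev Proj (n : ℕ) : Type := Projectivization QBar (Fin (n + 1) → QBar)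

/-- The field generated by the entries of a vector of algebraic numbers. -/
abbrev coordField {n : ℕ} (x : Fin n → QBar) : IntermediateField ℚ QBar :=
  IntermediateField.adjoin ℚ (Set.range x)

instance coordField_numberField {n : ℕ} (x : Fin n → QBar) : NumberField (coordField x) where
  to_finiteDimensional := IntermediateField.finiteDimensional_adjoin
    fun y _ => isIntegral_qBar y

/-- The absolute logarithmic height of a vector of homogeneous coordinates, computed in the number
field `K` generated by the coordinates: the height relative to `K`, that is the sum over the places
`w` of `K` of `[K_w : ℚ_v] log max_i |x_i|_w`, divided by `[K : ℚ]`. -/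
def vectorHeight {n : ℕ} (x : Fin n → QBar) : ℝ :=
  Height.logHeight
    (fun i => (⟨x i, IntermediateField.subset_adjoin ℚ _ (Set.mem_range_self i)⟩ : coordField x)) /
      (Module.finrank ℚ (coordField x) : ℝ)

/-- The canonical height of a point of projective space, computed from a vector of homogeneous
coordinates (the value depends neither on this vector nor on the number field containing it). -/
def height {n : ℕ} (ξ : Proj n) : ℝ := vectorHeight ξ.rep

/-- The diagonal linear map `(x₀, …, xₙ) ↦ (x₀, γ₁ x₁, …, γₙ xₙ)`. -/
def diagMap {n : ℕ} (γ : Torus n) : (Fin (n + 1) → QBar) →ₗ[QBar] (Fin (n + 1) → QBar) where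
  toFun x i := ((Fin.cons 1 γ : Fin (n + 1) → QBarˣ) i : QBar) * x i
  map_add' x y := by ext i; simp [mul_add]
  map_smul' c x := by ext i; simp [mul_left_comm]

theorem diagMap_injective {n : ℕ} (γ : Torus n) : Function.Injective (diagMap γ) := by
  intro x y h
  ext i
  have hi := congrFun h i
  exact (Units.mul_right_inj ((Fin.cons 1 γ : Fin (n + 1) → QBarˣ) i)).1 hi

/-- Translation `[x₀ : … : xₙ] ↦ [x₀ : γ₁ x₁ : … : γₙ xₙ]` of projective space. -/
def translate {n : ℕ} (γ : Torus n) : Proj n → Proj n :=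
  Projectivization.map (diagMap γ) (diagMap_injective γ)

/-- The line `x₀ + x₁ + x₂ = 0` of the projective plane. -/
def line : Set (Proj 2) := {ξ | ξ.rep 0 + ξ.rep 1 + ξ.rep 2 = 0}

/-- The torus `(ℝ / 2πℤ)²` with its flat Euclidean metric. -/
abbrev AngleTorus : Type := PiLp 2 (fun _ : Fin 2 => AddCircle (2 * π))

/-- The exponential `u ↦ e^{iu}` on `ℝ / 2πℤ`. -/
def expI (u : AddCircle (2 * π)) : ℂ := (AddCircle.toCircle u : ℂ)

/-- The function `log max (|e^{iu₂} - e^{iu₁}|, |e^{iu₂} - 1|, |e^{iu₁} - 1|)`. Its value `-∞` at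
the single point `u = 0` is replaced by `Real.log 0 = 0`; this does not affect integrals with
respect to measures without atoms. -/
def logMax (u : AngleTorus) : ℝ :=
  Real.log (max ‖expI (u 1) - expI (u 0)‖ (max ‖expI (u 1) - 1‖ ‖expI (u 0) - 1‖))

/-- The union, over the units `j` modulo `e`, of the closed curves ("segments")
`a₁ u₁ + a₂ u₂ = 2π j / e` of `(ℝ / 2πℤ)²`. -/
def segments (a : Fin 2 → ℤ) (e : ℕ) : Set AngleTorus :=
  {u | ∃ j : (ZMod e)ˣ,
    a 0 • u 0 + a 1 • u 1 = ((2 * π * ((j : ZMod e).val : ℝ) / (e : ℝ) : ℝ) : AddCircle (2 * π))}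

/-- The normalized length measure on the union of segments: one-dimensional Hausdorff measure for
the Euclidean metric, restricted to this union and divided by its total mass. -/
def segmentMeasure (a : Fin 2 → ℤ) (e : ℕ) : Measure AngleTorus :=
  ProbabilityTheory.cond (Measure.hausdorffMeasure 1) (segments a e)

/-- The average of `logMax` over the union of segments. -/
def eta (a : Fin 2 → ℤ) (e : ℕ) : ℝ := ∫ u, logMax u ∂(segmentMeasure a e)

/-- The odd Dirichlet character modulo `3`. -/
def chiNegThree : DirichletCharacter ℂ 3 :=
  haveI : Fact (Nat.Prime 3) := ⟨Nat.prime_three⟩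
  (quadraticChar (ZMod 3)).ringHomComp (Int.castRingHom ℂ)

end TorusHeight

end

open TorusHeight

/-!
The line `C` and its translate by a torsion point `ω ≠ 1` meet in the single point whose
homogeneous coordinates are the cross product of `(1, 1, 1)` and `(1, ω₁⁻¹, ω₂⁻¹)`
(`line_inter_translate`). These coordinates are algebraic integers in the field `L` generated by
`ω`, so the height is the sum of two terms (`mulHeight_eq_of_integral`). The archimedean one is
the average of `log max (|z₂ - z₁|, |z₂ - 1|, |z₁ - 1|)` over the Galois conjugates `(z₁, z₂)` of
`ω`. The nonarchimedean one is `-log N(I) / [L : ℚ]`, where `I` is the ideal generated by the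
coordinates.

Choose `b` with `a₁ b₁ + a₂ b₂ = 1`, so that `χ^a` and the character `ψ` with exponent `(-b₂, b₁)`
form a basis of the characters. Everything is controlled by `A`, the average of `log |1 - ψ|` over
the conjugates of `ω`. If `ψ(ω)` has order `n > 1`, its conjugates are the primitive `n`-th roots
of unity, and `A = log Φ_n(1) / φ(n)`, which tends to `0` as `n` grows
(`tendsto_log_div_totient`). Strictness makes `n` tend to infinity, as it does for the order of
the value of every character which is not a power of `χ^a` (`tendsto_orderOf_character`).

* The nonarchimedean term lies between `-A` and `0`: the coordinates of the point are congruent to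
  `0` modulo `I`, hence `ω₁` and `ω₂` are congruent to `1`, hence `1 - ψ(ω)` lies in `I`
  (`exists_conjugates`).
* The conjugates of `ω` become equidistributed on the segments. By Weyl's criterion this has to be
  checked for characters only (`tendsto_expect_of_dense`). The values of `χ^a` are
  the primitive `e`-th roots of unity, with equal weights, for the conjugates as for the segments,
  which settles its powers. For other characters the integral is `0`, and the averages are
  `μ(n) / φ(n)` for `n` tending to infinity.
* The integrand has a logarithmic singularity where both angles vanish. It dominates `log |1 - ψ|`
  up to a constant (`coordDist_le`), so no mass is lost at the singularity if the averages `A` of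
  `log |1 - ψ|` converge to its integral (`tendsto_expect_log`). They do: by Jensen's formula the
  integral is `0`.

The length measure on a segment is identified with Haar measure on the circle by its invariance
under translations (`lengthMeasure_restrict_fiber`), which makes the integrals over the segments
computable.

For `e = 1` the integral becomes one over the circle. For the first three vectors the integrand is
`log |1 - z|`, with integral `0`. For the other three it is `log |1 - z| + log⁺ |1 + z|`, and the
integral is the Mahler measure of `1 + x + y`, evaluated with Smyth's formula by integrating the
Taylor series of the logarithm (`circleAverage_posLog_eq_LFunction`).
-/

open scoped BigOperators

namespace TorusHeight

/-! ### Heights over number fields -/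

section Extension

variable {K L ι : Type*} [Field K] [NumberField K] [Field L] [NumberField L]

/-- For integral coordinates the product of all nonarchimedean factors of the height is the inverse
of the norm of the ideal generated by the coordinates, so that the height involves only this norm
and the complex embeddings. -/
theorem mulHeight_eq_of_integral [Finite ι] {x : ι → NumberField.RingOfIntegers K}
    (hx : x ≠ 0) :
    Height.mulHeight (fun i => (x i : K)) =
      (∏ σ : K →+* ℂ, ⨆ i, ‖σ (x i)‖) / (Ideal.span (Set.range x)).absNorm := by
  have hx' : (fun i => (x i : K)) ≠ 0 := by
    obtain ⟨i, hi⟩ := Function.ne_iff.mp hx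
    exact Function.ne_iff.mpr ⟨i, by simpa using hi⟩
  classical
  have h1 := NumberField.absNorm_mul_finprod_finitePlace_eq_one hx
  have hN : ((Ideal.span (Set.range x)).absNorm : ℝ) ≠ 0 := left_ne_zero_of_mul_eq_one h1
  rw [NumberField.mulHeight_eq hx', eq_div_iff hN, mul_assoc, mul_comm (∏ᶠ _, _), h1, mul_one]
  rw [← Finset.prod_fiberwise (s := Finset.univ)
    (g := fun σ : K →+* ℂ => NumberField.InfinitePlace.mk σ)]
  refine Finset.prod_congr rfl fun v _ => ?_
  rw [Finset.prod_congr rfl (g := fun _ => ⨆ i, v (x i)), Finset.prod_const]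
  · congr 1
    exact (NumberField.InfinitePlace.card_filter_mk_eq v).symm
  · intro σ hσ
    rw [← (Finset.mem_filter.mp hσ).2]
    rfl

/-- Every vector over a number field is integral after clearing denominators. -/
theorem exists_integral_scaling [Finite ι] (x : ι → K) :
    ∃ c : K, c ≠ 0 ∧ ∃ y : ι → NumberField.RingOfIntegers K, c • x = fun i => (y i : K) := by
  classical
  have := Fintype.ofFinite ι
  obtain ⟨b, hb⟩ := IsLocalization.exist_integer_multiples
    (nonZeroDivisors (NumberField.RingOfIntegers K)) Finset.univ x
  choose y hy using hb
  refine ⟨(b : NumberField.RingOfIntegers K), ?_, fun i => y i (Finset.mem_univ i), ?_⟩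
  · simp
  · funext i
    have := hy i (Finset.mem_univ i)
    simp only [Pi.smul_apply, smul_eq_mul]
    rw [Algebra.smul_def] at this
    exact this.symm

/-- Every complex embedding of `K` has `[L : K]` extensions to `L`. -/
theorem prod_embeddings_extension [Algebra K L] {M : Type*} [CommMonoid M]
    (f : (K →+* ℂ) → M) :
    ∏ σ : L →+* ℂ, f (σ.comp (algebraMap K L)) =
      (∏ σ : K →+* ℂ, f σ) ^ Module.finrank K L := by
  classical
  have : FiniteDimensional K L := Module.Finite.of_restrictScalars_finite ℚ K L
  rw [← Finset.prod_fiberwise (s := Finset.univ)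
    (g := fun σ : L →+* ℂ => σ.comp (algebraMap K L)), ← Finset.prod_pow]
  refine Finset.prod_congr rfl fun τ _ => ?_
  rw [Finset.prod_congr rfl (g := fun _ => f τ), Finset.prod_const]
  · congr 1
    let : Algebra K ℂ := τ.toAlgebra
    rw [← AlgHom.card K L ℂ, ← Fintype.card_subtype]
    refine Fintype.card_congr
      { toFun := fun σ => { toRingHom := σ.1, commutes' := fun r => congrArg (· r) σ.2 }
        invFun := fun σ => ⟨σ.toRingHom, RingHom.ext fun r => σ.commutes r⟩
        left_inv := fun _ => rfl
        right_inv := fun _ => rfl }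
  · intro σ hσ
    rw [(Finset.mem_filter.mp hσ).2]

theorem sum_embeddings_extension [Algebra K L] {M : Type*} [AddCommMonoid M]
    (f : (K →+* ℂ) → M) :
    ∑ σ : L →+* ℂ, f (σ.comp (algebraMap K L)) = Module.finrank K L • ∑ σ : K →+* ℂ, f σ :=
  prod_embeddings_extension (M := Multiplicative M) f

/-- After scaling to integral coordinates both the archimedean part and the ideal norm are raised to
the power `[L : K]`. -/
theorem logHeight_extension [Finite ι] [Algebra K L] (x : ι → K) :
    Height.logHeight (fun i => algebraMap K L (x i)) =
      Module.finrank K L * Height.logHeight x := by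
  rcases eq_or_ne x 0 with rfl | hx
  · have : (fun i : ι => algebraMap K L ((0 : ι → K) i)) = 0 := by ext; simp
    rw [this]; simp
  obtain ⟨c, hc, y, hy⟩ := exists_integral_scaling x
  have hy0 : y ≠ 0 := by
    rintro rfl
    apply hx
    have : c • x = 0 := by rw [hy]; ext; simp
    exact (smul_eq_zero.mp this).resolve_left hc
  let z : ι → NumberField.RingOfIntegers L :=
    fun i => algebraMap (NumberField.RingOfIntegers K) (NumberField.RingOfIntegers L) (y i)
  have hinj : Function.Injective
      (algebraMap (NumberField.RingOfIntegers K) (NumberField.RingOfIntegers L)) :=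
    FaithfulSMul.algebraMap_injective _ _
  have hz0 : z ≠ 0 := by
    obtain ⟨i, hi⟩ := Function.ne_iff.mp hy0
    exact Function.ne_iff.mpr ⟨i, by simpa [z] using hi⟩
  have hzy : ∀ i, (z i : L) = algebraMap K L (y i) := fun i => rfl
  have hL : algebraMap K L c • (fun i => algebraMap K L (x i)) = fun i => (z i : L) := by
    funext i
    rw [hzy, ← congrFun hy i]
    simp
  rw [← Height.logHeight_smul_eq_logHeight x hc,
    ← Height.logHeight_smul_eq_logHeight (fun i => algebraMap K L (x i))
      (show algebraMap K L c ≠ 0 by simpa using hc), hL, hy,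
    Height.logHeight_eq_log_mulHeight, Height.logHeight_eq_log_mulHeight,
    mulHeight_eq_of_integral hz0, mulHeight_eq_of_integral hy0, ← Real.log_pow, div_pow]
  congr 2
  · rw [← prod_embeddings_extension (L := L) (fun σ : K →+* ℂ => ⨆ i, ‖σ (y i)‖)]
    rfl
  · have : Ideal.span (Set.range z) = (Ideal.span (Set.range y)).map
        (algebraMap (NumberField.RingOfIntegers K) (NumberField.RingOfIntegers L)) := by
      rw [Ideal.map_span, ← Set.range_comp]; rfl
    rw [this, Ideal.absNorm_algebraMap]
    push_cast
    congr 1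
    exact (IsFractionRing.finrank_eq _ K _ L).symm

end Extension

/-- The absolute height depends neither on the number field in which it is computed nor on the
choice of homogeneous coordinates: compare both sides in the compositum of `K` and `L`. -/
theorem logHeight_div_finrank_eq {ι : Type*} [Finite ι] (K L : IntermediateField ℚ QBar)
    [NumberField K] [NumberField L] (x : ι → K) (y : ι → L) {c : QBar} (hc : c ≠ 0)
    (h : ∀ i, (x i : QBar) = c * y i) :
    Height.logHeight x / (Module.finrank ℚ K : ℝ) =
      Height.logHeight y / (Module.finrank ℚ L : ℝ) := by
  by_cases hy : y = 0
  · have hx : x = 0 := by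
      funext i
      have := h i
      rw [hy] at this
      simpa using this
    rw [hx, hy]; simp
  obtain ⟨j, hj⟩ := Function.ne_iff.mp hy
  have hj' : (y j : QBar) ≠ 0 := by simpa using hj
  let M : IntermediateField ℚ QBar := K ⊔ L
  have : FiniteDimensional ℚ K := NumberField.to_finiteDimensional
  have : FiniteDimensional ℚ L := NumberField.to_finiteDimensional
  have : NumberField M := { to_finiteDimensional := IntermediateField.finiteDimensional_sup K L }
  have hK : K ≤ M := le_sup_left
  have hL : L ≤ M := le_sup_right
  let _ : Algebra K M := (IntermediateField.inclusion hK).toRingHom.toAlgebra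
  let _ : Algebra L M := (IntermediateField.inclusion hL).toRingHom.toAlgebra
  have hcM : c ∈ M := by
    have : c = (x j : QBar) / y j := by rw [h j]; field_simp
    rw [this]
    exact M.div_mem (hK (x j).2) (hL (y j).2)
  have e : (fun i => algebraMap K M (x i)) = (⟨c, hcM⟩ : M) • fun i => algebraMap L M (y i) := by
    funext i
    exact Subtype.ext (h i)
  have hsm := Height.logHeight_smul_eq_logHeight (fun i => algebraMap L M (y i))
    (c := (⟨c, hcM⟩ : M)) (fun h0 => hc (congrArg Subtype.val h0))
  rw [← e, logHeight_extension, logHeight_extension] at hsm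
  have hKM : Module.finrank ℚ K * Module.finrank K M = Module.finrank ℚ M :=
    Module.finrank_mul_finrank ℚ K M
  have hLM : Module.finrank ℚ L * Module.finrank L M = Module.finrank ℚ M :=
    Module.finrank_mul_finrank ℚ L M
  have h0 : 0 < Module.finrank ℚ M := Module.finrank_pos
  have hne : Module.finrank K M ≠ 0 := fun h' => by rw [h', mul_zero] at hKM; omega
  have hpK : (0 : ℝ) < Module.finrank ℚ K := by exact_mod_cast Module.finrank_pos
  have hpL : (0 : ℝ) < Module.finrank ℚ L := by exact_mod_cast Module.finrank_pos
  have hmul : (Module.finrank ℚ K : ℝ) * Module.finrank K M =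
      Module.finrank ℚ L * Module.finrank L M := by exact_mod_cast hKM.trans hLM.symm
  have hKM0 : (Module.finrank K M : ℝ) ≠ 0 := by exact_mod_cast hne
  rw [div_eq_div_iff hpK.ne' hpL.ne']
  apply mul_left_cancel₀ hKM0
  linear_combination (Module.finrank ℚ L : ℝ) * hsm - Height.logHeight y * hmul

/-- The height of a point of projective space may be computed from any homogeneous coordinates, in
any number field containing them. -/
theorem height_mk {n : ℕ} (L : IntermediateField ℚ QBar) [NumberField L] (x : Fin (n + 1) → L)
    (hx : (fun i => (x i : QBar)) ≠ 0) :
    height (Projectivization.mk QBar _ hx) =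
      Height.logHeight x / (Module.finrank ℚ L : ℝ) := by
  obtain ⟨c, hc⟩ := Projectivization.exists_smul_eq_mk_rep QBar _ hx
  exact logHeight_div_finrank_eq (coordField _) L _ x c.ne_zero fun i => (congrFun hc i).symm

theorem expect_embeddings (L : Type*) [Field L] [NumberField L] (f : (L →+* ℂ) → ℝ) :
    𝔼 σ, f σ = (∑ σ, f σ) / (Module.finrank ℚ L : ℝ) := by
  rw [Fintype.expect_eq_sum_div_card, NumberField.Embeddings.card]

theorem iSup_norm_embedding_pos {L ι : Type*} [Field L] [Finite ι]
    {x : ι → NumberField.RingOfIntegers L} (hx : x ≠ 0) (σ : L →+* ℂ) : 0 < ⨆ i, ‖σ (x i)‖ := by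
  obtain ⟨i, hi⟩ := Function.ne_iff.mp hx
  refine lt_of_lt_of_le ?_ (le_ciSup (Set.finite_range fun i => ‖σ (x i)‖).bddAbove i)
  simpa using hi

section Bounds

variable {L ι : Type*} [Field L] [NumberField L] [Finite ι]
  {x : ι → NumberField.RingOfIntegers L}

theorem prod_norm_embeddings (z : NumberField.RingOfIntegers L) :
    ∏ σ : L →+* ℂ, ‖σ z‖ = (Ideal.span {z}).absNorm := by
  rw [Ideal.absNorm_span_singleton, ← norm_prod]
  have h1 := Algebra.norm_eq_prod_embeddings ℚ ℂ (z : L)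
  have h2 : ∏ σ : L →+* ℂ, σ z = ∏ σ : L →ₐ[ℚ] ℂ, σ (z : L) :=
    Fintype.prod_equiv (RingHom.equivRatAlgHom L ℂ) _ _ fun σ => rfl
  rw [h2, ← h1, ← Algebra.coe_norm_int]
  simp [Nat.cast_natAbs]

/-- The nonarchimedean part of the height of a vector of algebraic integers is at most `0`. -/
theorem logHeight_le_expect (hx : x ≠ 0) :
    Height.logHeight (fun i => (x i : L)) / (Module.finrank ℚ L : ℝ) ≤
      𝔼 σ : L →+* ℂ, Real.log (⨆ i, ‖σ (x i)‖) := by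
  rw [expect_embeddings]
  gcongr
  rw [Height.logHeight_eq_log_mulHeight, mulHeight_eq_of_integral hx, ← Real.log_prod
    fun σ _ => (iSup_norm_embedding_pos hx σ).ne']
  have hN : (Ideal.span (Set.range x)).absNorm ≠ 0 := by
    rw [Ne, Ideal.absNorm_eq_zero_iff, Ideal.span_eq_bot]
    obtain ⟨i, hi⟩ := Function.ne_iff.mp hx
    exact fun h => hi (h _ ⟨i, rfl⟩)
  have hP : 0 < ∏ σ : L →+* ℂ, ⨆ i, ‖σ (x i)‖ :=
    Finset.prod_pos fun σ _ => iSup_norm_embedding_pos hx σ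
  apply Real.log_le_log
  · positivity
  · exact div_le_self hP.le (by exact_mod_cast Nat.one_le_iff_ne_zero.mpr hN)

/-- The nonarchimedean part of the height of a vector of algebraic integers is bounded from below
through any nonzero element `z` of the ideal `I` generated by the coordinates: the norm of `I`
divides the norm of `z`. -/
theorem expect_sub_le_logHeight (hx : x ≠ 0) {z : NumberField.RingOfIntegers L} (hz0 : z ≠ 0)
    (hz : z ∈ Ideal.span (Set.range x)) :
    (𝔼 σ : L →+* ℂ, Real.log (⨆ i, ‖σ (x i)‖)) - (𝔼 σ : L →+* ℂ, Real.log ‖σ z‖) ≤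
      Height.logHeight (fun i => (x i : L)) / (Module.finrank ℚ L : ℝ) := by
  rw [expect_embeddings, expect_embeddings, ← sub_div]
  gcongr
  have hz' : ∀ σ : L →+* ℂ, ‖σ z‖ ≠ 0 := fun σ => by simpa using hz0
  have hle : Ideal.span {z} ≤ Ideal.span (Set.range x) := by
    rw [Ideal.span_singleton_le_iff_mem]; exact hz
  have hN : (Ideal.span (Set.range x)).absNorm ≠ 0 := by
    rw [Ne, Ideal.absNorm_eq_zero_iff]
    intro h
    rw [h] at hz
    exact hz0 hz
  have hNz : (Ideal.span {z}).absNorm ≠ 0 := by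
    rwa [Ne, Ideal.absNorm_eq_zero_iff, Ideal.span_singleton_eq_bot]
  have hP : 0 < ∏ σ : L →+* ℂ, ⨆ i, ‖σ (x i)‖ :=
    Finset.prod_pos fun σ _ => iSup_norm_embedding_pos hx σ
  rw [Height.logHeight_eq_log_mulHeight, mulHeight_eq_of_integral hx, ← Real.log_prod
    fun σ _ => (iSup_norm_embedding_pos hx σ).ne', ← Real.log_prod fun σ _ => hz' σ,
    prod_norm_embeddings, Real.log_div hP.ne' (by exact_mod_cast hN)]
  gcongr
  exact Nat.le_of_dvd (Nat.pos_of_ne_zero hNz) (Ideal.absNorm_dvd_absNorm_of_le hle)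

end Bounds

/-! ### Averages over Galois orbits of roots of unity -/

/-- The images of a primitive `n`-th root of unity `ρ` under the complex embeddings of any number
field containing it run uniformly through all complex primitive `n`-th roots of unity, by
irreducibility of the cyclotomic polynomial over `ℚ`. -/
theorem expect_embeddings_primitiveRoots {L E : Type*} [Field L] [NumberField L] [Field E]
    [CharZero E] {ρ : L} {n : ℕ} (hn : n ≠ 0) (hρ : IsPrimitiveRoot ρ n) (g : ℂ → E) :
    𝔼 σ : L →+* ℂ, g (σ ρ) = 𝔼 z ∈ primitiveRoots n ℂ, g z := by
  have : NeZero n := ⟨hn⟩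
  let K : IntermediateField ℚ L := IntermediateField.adjoin ℚ {ρ}
  have : IsCyclotomicExtension {n} ℚ K := hρ.intermediateField_adjoin_isCyclotomicExtension ℚ
  have : NumberField K := NumberField.of_intermediateField K
  let ρ' : K := ⟨ρ, IntermediateField.mem_adjoin_simple_self ℚ ρ⟩
  have hρ' : IsPrimitiveRoot ρ' n :=
    IsPrimitiveRoot.of_map_of_injective (f := algebraMap K L) hρ (algebraMap K L).injective
  have hirr := Polynomial.cyclotomic.irreducible_rat (NeZero.pos n)
  have hs : ∑ σ : L →+* ℂ, g (σ ρ) = Module.finrank K L • ∑ σ : K →+* ℂ, g (σ ρ') :=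
    sum_embeddings_extension (K := K) (L := L) (fun σ => g (σ ρ'))
  have hK : ∑ σ : K →+* ℂ, g (σ ρ') = ∑ z ∈ primitiveRoots n ℂ, g z := by
    rw [← Finset.sum_coe_sort (primitiveRoots n ℂ) g]
    exact Fintype.sum_equiv ((RingHom.equivRatAlgHom K ℂ).trans
      (hρ'.embeddingsEquivPrimitiveRoots ℂ hirr)) _ _ fun σ => rfl
  have hcK : Module.finrank ℚ K = (primitiveRoots n ℂ).card := by
    rw [IsCyclotomicExtension.finrank K hirr, (Complex.isPrimitiveRoot_exp n hn).card_primitiveRoots]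
  have hcL : Module.finrank ℚ K * Module.finrank K L = Module.finrank ℚ L :=
    Module.finrank_mul_finrank ℚ K L
  have h0 : 0 < Module.finrank ℚ L := Module.finrank_pos
  have hne : Module.finrank K L ≠ 0 := fun h' => by rw [h', mul_zero] at hcL; omega
  have hne' : (Module.finrank K L : E) ≠ 0 := by exact_mod_cast hne
  rw [Fintype.expect_eq_sum_div_card, Finset.expect_eq_sum_div_card, hs, hK,
    NumberField.Embeddings.card, ← hcK, ← hcL, nsmul_eq_mul, Nat.cast_mul,
    mul_comm (Module.finrank ℚ K : E), mul_div_mul_left _ _ hne']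

/-- By Möbius inversion the sum of the primitive `n`-th roots of unity is `μ n`. -/
theorem norm_sum_primitiveRoots_le (n : ℕ) (hn : 0 < n) : ‖∑ z ∈ primitiveRoots n ℂ, z‖ ≤ 1 := by
  have key : ∀ m > 0, ∑ d ∈ m.divisors, ∑ z ∈ primitiveRoots d ℂ, z =
      if m = 1 then (1 : ℂ) else 0 := by
    intro m hm
    have : NeZero m := ⟨hm.ne'⟩
    have hS : ∑ d ∈ m.divisors, ∑ z ∈ primitiveRoots d ℂ, z =
        ∑ z ∈ Polynomial.nthRootsFinset m (1 : ℂ), z := by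
      rw [IsPrimitiveRoot.nthRoots_one_eq_biUnion_primitiveRoots, Finset.sum_biUnion]
      intro a _ b _ hab
      exact IsPrimitiveRoot.disjoint hab
    split_ifs with h1
    · subst h1; simp
    · rw [hS]
      have hζ := Complex.isPrimitiveRoot_exp m hm.ne'
      set ζ := Complex.exp (2 * π * Complex.I / m)
      have hζ1 : ζ ≠ 1 := hζ.ne_one (by omega)
      -- multiplication by a nontrivial root of unity permutes the roots of unity
      have : ζ * ∑ z ∈ Polynomial.nthRootsFinset m (1 : ℂ), z =
          ∑ z ∈ Polynomial.nthRootsFinset m (1 : ℂ), z := by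
        rw [Finset.mul_sum]
        have hζm : ζ ^ m = 1 := hζ.pow_eq_one
        refine Finset.sum_nbij' (fun z => ζ * z) (fun z => ζ⁻¹ * z) ?_ ?_ ?_ ?_ ?_
        · intro z hz
          rw [Polynomial.mem_nthRootsFinset hm] at hz ⊢
          rw [mul_pow, hz, hζm, one_mul]
        · intro z hz
          rw [Polynomial.mem_nthRootsFinset hm] at hz ⊢
          rw [mul_pow, hz, inv_pow, hζm, inv_one, one_mul]
        · intro z _
          rw [inv_mul_cancel_left₀ (hζ.ne_zero hm.ne')]
        · intro z _
          rw [mul_inv_cancel_left₀ (hζ.ne_zero hm.ne')]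
        · intro z _; rfl
      have h2 : (ζ - 1) * ∑ z ∈ Polynomial.nthRootsFinset m (1 : ℂ), z = 0 := by
        rw [sub_mul, this]; ring
      exact (mul_eq_zero.mp h2).resolve_left (sub_ne_zero.mpr hζ1)
  have h := (ArithmeticFunction.sum_eq_iff_sum_mul_moebius_eq (R := ℂ)
    (f := fun d => ∑ z ∈ primitiveRoots d ℂ, z) (g := fun m => if m = 1 then 1 else 0)).mp key n hn
  rw [← h, Finset.sum_eq_single_of_mem (n, 1) (by simp [hn.ne'])]
  · simp only [if_true, mul_one, Complex.norm_intCast]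
    exact_mod_cast ArithmeticFunction.abs_moebius_le_one
  · rintro ⟨a, b⟩ hab hne
    rw [Nat.mem_divisorsAntidiagonal] at hab
    have : b ≠ 1 := by
      rintro rfl
      exact hne (by simpa using hab.1)
    simp [this]

/-- An elementary lower bound for Euler's function. The sharper bound for odd `n` is what makes the
induction over coprime factors work, since the loss of a factor `2` occurs only at the prime `2`. -/
theorem le_totient_sq (n : ℕ) : (Odd n → n ≤ n.totient ^ 2) ∧ n ≤ 2 * n.totient ^ 2 := by
  induction n using Nat.recOnPosPrimePosCoprime with
  | prime_pow p k hp hk =>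
    obtain ⟨j, rfl⟩ : ∃ j, k = j + 1 := ⟨k - 1, by omega⟩
    rw [Nat.totient_prime_pow_succ hp]
    have hpj : 1 ≤ p ^ j := Nat.one_le_pow _ _ hp.pos
    have h2 : p ≠ 2 → p ^ (j + 1) ≤ (p ^ j * (p - 1)) ^ 2 := by
      intro h
      have h3 : 3 ≤ p := by have := hp.two_le; omega
      obtain ⟨q, rfl⟩ : ∃ q, p = q + 1 := ⟨p - 1, by omega⟩
      rw [pow_succ, mul_pow, Nat.add_sub_cancel]
      apply Nat.mul_le_mul
      · nlinarith
      · nlinarith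
    refine ⟨fun ho => h2 ?_, ?_⟩
    · rintro rfl
      rw [Nat.odd_pow_iff (by omega)] at ho
      exact absurd ho (by decide)
    · by_cases h : p = 2
      · subst h
        rw [pow_succ]
        nlinarith
      · exact (h2 h).trans (by omega)
  | zero => simp
  | one => simp
  | coprime a b ha hb hab iha ihb =>
    rw [Nat.totient_mul hab, mul_pow]
    refine ⟨fun ho => ?_, ?_⟩
    · rw [Nat.odd_mul] at ho
      exact Nat.mul_le_mul (iha.1 ho.1) (ihb.1 ho.2)
    · rcases Nat.even_or_odd a with h | h
      · have hbo : Odd b := by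
          rw [← Nat.not_even_iff_odd]
          intro h'
          have := Nat.dvd_gcd h.two_dvd h'.two_dvd
          rw [hab] at this
          omega
        rw [← mul_assoc]
        exact Nat.mul_le_mul iha.2 (ihb.1 hbo)
      · calc a * b ≤ a.totient ^ 2 * (2 * b.totient ^ 2) := Nat.mul_le_mul (iha.1 h) ihb.2
          _ = _ := by ring

theorem tendsto_totient : Tendsto Nat.totient atTop atTop := by
  rw [tendsto_atTop]
  intro b
  filter_upwards [eventually_ge_atTop (2 * b ^ 2)] with n hn
  have := (le_totient_sq n).2
  by_contra! h
  have : n.totient ^ 2 < b ^ 2 := Nat.pow_lt_pow_left h (by omega)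
  omega

theorem tendsto_log_div_totient :
    Tendsto (fun n : ℕ => Real.log n / n.totient) atTop (𝓝 0) := by
  have h : Tendsto (fun n : ℕ => √2 * (Real.log n / (n : ℝ) ^ (1 / 2 : ℝ))) atTop (𝓝 0) := by
    have := (isLittleO_log_rpow_atTop (show (0 : ℝ) < 1 / 2 by norm_num)).tendsto_div_nhds_zero
    simpa using (this.comp tendsto_natCast_atTop_atTop).const_mul √2
  refine squeeze_zero' ?_ ?_ h
  · exact Eventually.of_forall fun n => by positivity
  · filter_upwards [eventually_ge_atTop 1] with n hn
    have h1 : (n : ℝ) ≤ 2 * (n.totient : ℝ) ^ 2 := by exact_mod_cast (le_totient_sq n).2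
    have h2 : (n : ℝ) ^ (1 / 2 : ℝ) ≤ √2 * n.totient := by
      rw [← Real.sqrt_eq_rpow]
      calc √(n : ℝ) ≤ √(2 * (n.totient : ℝ) ^ 2) := Real.sqrt_le_sqrt h1
        _ = _ := by rw [Real.sqrt_mul (by norm_num), Real.sqrt_sq (by positivity)]
    have hpos : 0 < (n : ℝ) ^ (1 / 2 : ℝ) := by positivity
    have ht : 0 < (n.totient : ℝ) := by exact_mod_cast Nat.totient_pos.mpr hn
    have hl : 0 ≤ Real.log n := Real.log_natCast_nonneg n
    rw [mul_div_assoc', div_le_div_iff₀ ht hpos]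
    nlinarith

theorem norm_expect_primitiveRoots_le (n : ℕ) (hn : 0 < n) :
    ‖𝔼 z ∈ primitiveRoots n ℂ, z‖ ≤ (n.totient : ℝ)⁻¹ := by
  rw [Finset.expect_eq_sum_div_card, norm_div,
    (Complex.isPrimitiveRoot_exp n hn.ne').card_primitiveRoots, Complex.norm_natCast, ← one_div]
  gcongr
  exact norm_sum_primitiveRoots_le n hn

/-- The value `Φ_n(1)` is a prime `p` if `n > 1` is a power of `p`, and `1` if `n > 1` is not a
prime power. -/
theorem one_le_norm_cyclotomic_one {n : ℕ} (hn : 1 < n) :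
    1 ≤ ‖(Polynomial.cyclotomic n ℂ).eval 1‖ ∧ ‖(Polynomial.cyclotomic n ℂ).eval 1‖ ≤ n := by
  by_cases h : IsPrimePow n
  · obtain ⟨p, k, hp, hk, rfl⟩ := h
    obtain ⟨j, rfl⟩ : ∃ j, k = j + 1 := ⟨k - 1, by omega⟩
    have : Fact p.Prime := ⟨hp.nat_prime⟩
    rw [Polynomial.eval_one_cyclotomic_prime_pow, Complex.norm_natCast]
    have h1 : 1 ≤ p := hp.nat_prime.one_lt.le
    exact ⟨by exact_mod_cast h1, by exact_mod_cast Nat.le_self_pow (by omega) p⟩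
  · rw [Polynomial.eval_one_cyclotomic_not_prime_pow]
    · simp only [norm_one, le_refl, true_and]
      exact_mod_cast hn.le
    · intro p hp k hk
      apply h
      rw [← hk]
      refine hp.isPrimePow.pow ?_
      rintro rfl
      simp at hk
      omega

/-- The average of `log |1 - z|` over the primitive `n`-th roots of unity is `log Φ_n(1) / φ(n)`,
hence it is nonnegative and small. -/
theorem expect_log_norm_one_sub_primitiveRoots {n : ℕ} (hn : 1 < n) :
    0 ≤ 𝔼 z ∈ primitiveRoots n ℂ, Real.log ‖1 - z‖ ∧
      𝔼 z ∈ primitiveRoots n ℂ, Real.log ‖1 - z‖ ≤ Real.log n / n.totient := by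
  have h := one_le_norm_cyclotomic_one hn
  have hprod : ‖(Polynomial.cyclotomic n ℂ).eval 1‖ = ∏ z ∈ primitiveRoots n ℂ, ‖1 - z‖ := by
    rw [Polynomial.cyclotomic_eq_prod_X_sub_primitiveRoots
      (Complex.isPrimitiveRoot_exp n (by omega)), Polynomial.eval_prod, norm_prod]
    simp
  have hsum : ∑ z ∈ primitiveRoots n ℂ, Real.log ‖1 - z‖ =
      Real.log ‖(Polynomial.cyclotomic n ℂ).eval 1‖ := by
    rw [hprod, Real.log_prod]
    intro z hz
    rw [norm_ne_zero_iff, sub_ne_zero]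
    rintro rfl
    have := (mem_primitiveRoots (by omega)).mp hz
    exact this.ne_one hn rfl
  rw [Finset.expect_eq_sum_div_card, hsum,
    (Complex.isPrimitiveRoot_exp n (by omega)).card_primitiveRoots]
  refine ⟨div_nonneg (Real.log_nonneg h.1) (Nat.cast_nonneg _), ?_⟩
  gcongr
  · linarith
  · exact h.2

/-! ### Equidistribution of finite sets of points -/

section Equidistribution

variable {X : Type*} [TopologicalSpace X] [CompactSpace X] [MeasurableSpace X] [BorelSpace X]
  {τ : Measure X} [IsProbabilityMeasure τ]
  {ι : ℕ → Type*} [∀ l, Fintype (ι l)] [∀ l, Nonempty (ι l)] {x : ∀ l, ι l → X}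

theorem norm_expect_le {κ : Type*} [Fintype κ] [Nonempty κ] {f : κ → ℂ} {C : ℝ}
    (h : ∀ i, ‖f i‖ ≤ C) : ‖𝔼 i, f i‖ ≤ C := by
  have hc : (0 : ℝ) < Fintype.card κ := by exact_mod_cast Fintype.card_pos
  rw [Fintype.expect_eq_sum_div_card, norm_div, Complex.norm_natCast, div_le_iff₀ hc]
  refine (norm_sum_le_of_le _ fun i _ => h i).trans ?_
  simp [mul_comm]

theorem continuousMap_integrable {E : Type*} [NormedAddCommGroup E] [SecondCountableTopology E]
    (f : C(X, E)) : Integrable f τ := by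
  obtain ⟨C, hC⟩ := isCompact_univ.exists_bound_of_continuousOn f.continuous.continuousOn
  exact Integrable.of_bound f.continuous.aestronglyMeasurable C
    (Eventually.of_forall fun y => hC y (Set.mem_univ y))

/-- Weyl's criterion: convergence of the averages for a family of functions with dense span implies
convergence for all continuous functions. -/
theorem tendsto_expect_of_dense {S : Set C(X, ℂ)}
    (hS : (Submodule.span ℂ S).topologicalClosure = ⊤)
    (h : ∀ f ∈ S, Tendsto (fun l => 𝔼 i, f (x l i)) atTop (𝓝 (∫ y, f y ∂τ))) (f : C(X, ℂ)) :
    Tendsto (fun l => 𝔼 i, f (x l i)) atTop (𝓝 (∫ y, f y ∂τ)) := by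
  have hspan : ∀ g ∈ Submodule.span ℂ S,
      Tendsto (fun l => 𝔼 i, g (x l i)) atTop (𝓝 (∫ y, g y ∂τ)) := by
    intro g hg
    induction hg using Submodule.span_induction with
    | mem g hg => exact h g hg
    | zero => simp
    | add g g' _ _ hg hg' =>
      simp only [ContinuousMap.add_apply, Finset.expect_add_distrib]
      rw [integral_add (continuousMap_integrable g) (continuousMap_integrable g')]
      exact hg.add hg'
    | smul c g _ hg =>
      simp only [ContinuousMap.smul_apply, smul_eq_mul, ← Finset.mul_expect]
      rw [integral_const_mul]
      exact hg.const_mul c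
  have hf : f ∈ closure (Submodule.span ℂ S : Set C(X, ℂ)) := by
    rw [← Submodule.topologicalClosure_coe, hS]; trivial
  rw [Metric.tendsto_atTop]
  intro ε hε
  obtain ⟨g, hg, hfg⟩ := Metric.mem_closure_iff.mp hf (ε / 3) (by positivity)
  obtain ⟨N, hN⟩ := Metric.tendsto_atTop.mp (hspan g hg) (ε / 3) (by positivity)
  refine ⟨N, fun l hl => ?_⟩
  have hpt : ∀ y, ‖f y - g y‖ ≤ dist f g := fun y => by
    rw [← dist_eq_norm]; exact ContinuousMap.dist_apply_le_dist y
  have h1 : ‖𝔼 i, f (x l i) - 𝔼 i, g (x l i)‖ ≤ dist f g := by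
    rw [← Finset.expect_sub_distrib]
    exact norm_expect_le fun i => hpt _
  have h2 : ‖∫ y, f y ∂τ - ∫ y, g y ∂τ‖ ≤ dist f g := by
    rw [← integral_sub (continuousMap_integrable f) (continuousMap_integrable g)]
    simpa using norm_integral_le_of_norm_le_const (μ := τ) (Eventually.of_forall hpt)
  have h3 := hN l hl
  rw [dist_eq_norm] at h3 ⊢
  calc ‖𝔼 i, f (x l i) - ∫ y, f y ∂τ‖
      = ‖(𝔼 i, f (x l i) - 𝔼 i, g (x l i)) + (𝔼 i, g (x l i) - ∫ y, g y ∂τ) -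
          (∫ y, f y ∂τ - ∫ y, g y ∂τ)‖ := by congr 1; ring
    _ ≤ ‖𝔼 i, f (x l i) - 𝔼 i, g (x l i)‖ + ‖𝔼 i, g (x l i) - ∫ y, g y ∂τ‖ +
          ‖∫ y, f y ∂τ - ∫ y, g y ∂τ‖ :=
        (norm_sub_le _ _).trans (by gcongr; exact norm_add_le _ _)
    _ < ε := by linarith

omit [CompactSpace X] [BorelSpace X] [IsProbabilityMeasure τ] [∀ l, Nonempty (ι l)] in
theorem tendsto_expect_real
    (h : ∀ f : C(X, ℂ), Tendsto (fun l => 𝔼 i, f (x l i)) atTop (𝓝 (∫ y, f y ∂τ)))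
    (f : C(X, ℝ)) : Tendsto (fun l => 𝔼 i, f (x l i)) atTop (𝓝 (∫ y, f y ∂τ)) := by
  have := h ⟨fun y => (f y : ℂ), by fun_prop⟩
  simp only [ContinuousMap.coe_mk] at this
  have h2 := (Complex.continuous_re.tendsto _).comp this
  rw [integral_complex_ofReal, Complex.ofReal_re] at h2
  refine h2.congr fun l => ?_
  simp only [Function.comp]
  rw [Fintype.expect_eq_sum_div_card, Fintype.expect_eq_sum_div_card]
  have : ((∑ i, (f (x l i) : ℂ)) / (Fintype.card (ι l) : ℂ)) =
    (((∑ i, f (x l i)) / (Fintype.card (ι l) : ℝ) : ℝ) : ℂ) := by push_cast; rfl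
  rw [this, Complex.ofReal_re]

/-- `log (max s t)` as a continuous function, for `t > 0`. -/
noncomputable def logTrunc (s : C(X, ℝ)) (t : ℝ) (ht : 0 < t) : C(X, ℝ) where
  toFun y := Real.log (max (s y) t)
  continuous_toFun := (by fun_prop : Continuous fun y => max (s y) t).log
    fun y => (lt_max_of_lt_right ht).ne'

/-- If `c * s ≤ M`, then truncating `log M` from below changes it by at most as much as the
corresponding truncation changes `log s`. -/
theorem logTrunc_sub_le {s M : ℝ} {c t : ℝ} (hc : 0 < c) (ht : 0 < t) (hs : 0 < s)
    (h : c * s ≤ M) :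
    |Real.log (max M (c * t)) - Real.log M| ≤ Real.log (max s t) - Real.log s := by
  have hM : 0 < M := lt_of_lt_of_le (by positivity) h
  have h1 : Real.log M ≤ Real.log (max M (c * t)) := Real.log_le_log hM (le_max_left _ _)
  have h2 : Real.log s ≤ Real.log (max s t) := Real.log_le_log hs (le_max_left _ _)
  rw [abs_of_nonneg (by linarith)]
  rcases le_total (c * t) M with h' | h'
  · rw [max_eq_left h']; linarith
  · have hst : s ≤ t := le_of_mul_le_mul_left (h.trans h') hc
    rw [max_eq_right h', max_eq_right hst, Real.log_mul hc.ne' ht.ne']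
    have : Real.log (c * s) ≤ Real.log M := Real.log_le_log (by positivity) h
    rw [Real.log_mul hc.ne' hs.ne'] at this
    linarith

theorem integrable_log_of_le {s M : C(X, ℝ)} {c : ℝ} (hc : 0 < c) (hs : ∀ y, 0 ≤ s y)
    (hM : ∀ y, c * s y ≤ M y) (hs0 : ∀ᵐ y ∂τ, s y ≠ 0)
    (hint : Integrable (fun y => Real.log (s y)) τ) : Integrable (fun y => Real.log (M y)) τ := by
  obtain ⟨B, hB⟩ := isCompact_univ.exists_bound_of_continuousOn M.continuous.continuousOn
  refine Integrable.mono' (g := fun y => |Real.log (s y)| + (|Real.log B| + |Real.log c|)) ?_ ?_ ?_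
  · exact hint.abs.add (integrable_const _)
  · exact (Real.measurable_log.comp M.continuous.measurable).aestronglyMeasurable
  · filter_upwards [hs0] with y hy
    have hsy : 0 < s y := lt_of_le_of_ne (hs y) (Ne.symm hy)
    have hMy : 0 < M y := lt_of_lt_of_le (by positivity) (hM y)
    have h1 : Real.log (M y) ≤ Real.log B :=
      Real.log_le_log hMy ((le_abs_self _).trans (hB y (Set.mem_univ y)))
    have h2 : Real.log c + Real.log (s y) ≤ Real.log (M y) := by
      rw [← Real.log_mul hc.ne' hy]; exact Real.log_le_log (by positivity) (hM y)
    rw [Real.norm_eq_abs, abs_le]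
    have := neg_abs_le (Real.log (s y))
    have := neg_abs_le (Real.log c)
    have := le_abs_self (Real.log B)
    have := abs_nonneg (Real.log (s y))
    have := abs_nonneg (Real.log c)
    have := abs_nonneg (Real.log B)
    constructor <;> linarith

omit [CompactSpace X] [IsProbabilityMeasure τ] in
theorem tendsto_integral_logTrunc {s : C(X, ℝ)} (hs : ∀ y, 0 ≤ s y) (hs0 : ∀ᵐ y ∂τ, s y ≠ 0)
    (hint : Integrable (fun y => Real.log (s y)) τ) :
    Tendsto (fun k : ℕ => ∫ y, Real.log (max (s y) (1 / ((k : ℝ) + 1))) ∂τ) atTop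
      (𝓝 (∫ y, Real.log (s y) ∂τ)) := by
  refine tendsto_integral_of_dominated_convergence (fun y => |Real.log (s y)|) ?_ hint.abs ?_ ?_
  · intro k
    exact (logTrunc s (1 / ((k : ℝ) + 1)) (by positivity)).continuous.aestronglyMeasurable
  · intro k
    filter_upwards [hs0] with y hy
    have hsy : 0 < s y := lt_of_le_of_ne (hs y) (Ne.symm hy)
    have hk : (1 : ℝ) / ((k : ℝ) + 1) ≤ 1 := by
      rw [div_le_one (by positivity)]; linarith [Nat.cast_nonneg (α := ℝ) k]
    rw [Real.norm_eq_abs]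
    rcases le_total (1 / ((k : ℝ) + 1)) (s y) with h | h
    · rw [max_eq_left h]
    · rw [max_eq_right h, abs_of_nonpos (Real.log_nonpos (by positivity) hk),
        abs_of_nonpos (Real.log_nonpos hsy.le (h.trans hk))]
      linarith [Real.log_le_log hsy h]
  · filter_upwards [hs0] with y hy
    have hsy : 0 < s y := lt_of_le_of_ne (hs y) (Ne.symm hy)
    apply tendsto_const_nhds.congr'
    filter_upwards [tendsto_one_div_add_atTop_nhds_zero_nat.eventually (gt_mem_nhds hsy)] with k hk
    rw [max_eq_left hk.le]

omit [∀ l, Nonempty (ι l)] in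
/-- Equidistribution against a function with a logarithmic singularity. If the averages of `log M`
are to converge to the integral, no mass may be lost at the zeros of `M`. This is ensured by
comparison with a function `s` such that `c * s ≤ M` for which the convergence is already known: the
error of truncating `log M` is at most that of truncating `log s`, both for the averages and for the
integrals. -/
theorem tendsto_expect_log
    (h : ∀ f : C(X, ℝ), Tendsto (fun l => 𝔼 i, f (x l i)) atTop (𝓝 (∫ y, f y ∂τ)))
    {s M : C(X, ℝ)} {c : ℝ} (hc : 0 < c) (hs : ∀ y, 0 ≤ s y)
    (hM : ∀ y, c * s y ≤ M y) (hs0 : ∀ᵐ y ∂τ, s y ≠ 0)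
    (hint : Integrable (fun y => Real.log (s y)) τ) (hx : ∀ᶠ l in atTop, ∀ i, s (x l i) ≠ 0)
    (hlim : Tendsto (fun l => 𝔼 i, Real.log (s (x l i))) atTop (𝓝 (∫ y, Real.log (s y) ∂τ))) :
    Tendsto (fun l => 𝔼 i, Real.log (M (x l i))) atTop (𝓝 (∫ y, Real.log (M y) ∂τ)) := by
  have hintM := integrable_log_of_le hc hs hM hs0 hint
  rw [Metric.tendsto_atTop]
  intro ε hε
  -- a truncation level at which the integral of `log s` changes by less than `ε / 4`
  obtain ⟨k, hk⟩ := (Metric.tendsto_atTop.mp (tendsto_integral_logTrunc hs hs0 hint) (ε / 4)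
    (by positivity))
  have hk := hk k le_rfl
  set t : ℝ := 1 / ((k : ℝ) + 1)
  have ht : 0 < t := by positivity
  set st := logTrunc s t ht
  set Mt := logTrunc M (c * t) (by positivity)
  have hdiff : Tendsto (fun l => (𝔼 i, st (x l i)) - 𝔼 i, Real.log (s (x l i))) atTop
      (𝓝 ((∫ y, st y ∂τ) - ∫ y, Real.log (s y) ∂τ)) := (h st).sub hlim
  have hk' : (∫ y, st y ∂τ) - ∫ y, Real.log (s y) ∂τ < ε / 4 :=
    lt_of_le_of_lt (le_abs_self _) (by rw [← Real.dist_eq]; exact hk)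
  have hlast : |∫ y, Mt y ∂τ - ∫ y, Real.log (M y) ∂τ| < ε / 4 := by
    refine lt_of_le_of_lt ?_ hk'
    rw [← integral_sub (continuousMap_integrable _) hintM,
      ← integral_sub (continuousMap_integrable _) hint]
    refine (abs_integral_le_integral_abs).trans (integral_mono_ae ?_ ?_ ?_)
    · exact ((continuousMap_integrable _).sub hintM).abs
    · exact (continuousMap_integrable _).sub hint
    · filter_upwards [hs0] with y hy
      exact logTrunc_sub_le hc ht (lt_of_le_of_ne (hs y) (Ne.symm hy)) (hM y)
  obtain ⟨N, hN⟩ := eventually_atTop.mp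
    ((hx.and (hdiff.eventually (gt_mem_nhds hk'))).and
      ((h Mt).eventually (Metric.ball_mem_nhds _ (show 0 < ε / 4 by positivity))))
  refine ⟨N, fun l hl => ?_⟩
  obtain ⟨⟨hxl, h1⟩, h2⟩ := hN l hl
  rw [Real.dist_eq] at h2
  have h3 : |(𝔼 i, Mt (x l i)) - 𝔼 i, Real.log (M (x l i))| ≤
      (𝔼 i, st (x l i)) - 𝔼 i, Real.log (s (x l i)) := by
    rw [← Finset.expect_sub_distrib, ← Finset.expect_sub_distrib]
    refine (Finset.abs_expect_le _ _).trans (Finset.expect_le_expect fun i _ => ?_)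
    exact logTrunc_sub_le hc ht (lt_of_le_of_ne (hs _) (Ne.symm (hxl i))) (hM _)
  rw [Real.dist_eq]
  rw [abs_lt] at h2 hlast ⊢
  rw [abs_le] at h3
  constructor <;> linarith

end Equidistribution

/-! ### The length measure on the segments -/

instance fact_two_pi_pos : Fact (0 < 2 * π) := ⟨Real.two_pi_pos⟩

section Coordinates

variable (a b : Fin 2 → ℤ)

/-- The linear form `u ↦ a₁ u₁ + a₂ u₂` on the torus of angles. -/
noncomputable def angleForm (u : AngleTorus) : AddCircle (2 * π) := a 0 • u 0 + a 1 • u 1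

/-- For `b` with `a₁ b₁ + a₂ b₂ = 1`, the second coordinate `u ↦ b₁ u₂ - b₂ u₁` which completes
`angleForm a` to an automorphism of the torus of angles. -/
noncomputable def angleCoord (u : AngleTorus) : AddCircle (2 * π) := b 0 • u 1 - b 1 • u 0

/-- The point of the torus of angles at which `angleForm a` is `c` and `angleCoord b` is `t`, when
`a₁ b₁ + a₂ b₂ = 1`. For fixed `c` this parametrizes a segment. -/
noncomputable def anglePoint (c t : AddCircle (2 * π)) : AngleTorus :=
  WithLp.toLp 2 ![b 0 • c - a 1 • t, b 1 • c + a 0 • t]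

theorem continuous_apply_angle (i : Fin 2) : Continuous fun u : AngleTorus => u i :=
  (continuous_apply i).comp (PiLp.continuous_ofLp 2 _)

theorem continuous_angleForm : Continuous (angleForm a) := by
  unfold angleForm
  exact ((continuous_apply_angle 0).zsmul _).add ((continuous_apply_angle 1).zsmul _)

theorem continuous_angleCoord : Continuous (angleCoord b) := by
  unfold angleCoord
  exact ((continuous_apply_angle 1).zsmul _).sub ((continuous_apply_angle 0).zsmul _)

theorem continuous_anglePoint (c : AddCircle (2 * π)) : Continuous (anglePoint a b c) := by
  refine (PiLp.continuous_toLp 2 _).comp (continuous_pi fun i => ?_)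
  fin_cases i
  · exact continuous_const.sub (continuous_id.zsmul _)
  · exact continuous_const.add (continuous_id.zsmul _)

theorem angleForm_add (u v : AngleTorus) : angleForm a (u + v) = angleForm a u + angleForm a v := by
  simp only [angleForm, PiLp.add_apply, smul_add]; abel

theorem angleCoord_add (u v : AngleTorus) :
    angleCoord b (u + v) = angleCoord b u + angleCoord b v := by
  simp only [angleCoord, PiLp.add_apply, smul_add]; abel

variable {a b} (h : a 0 * b 0 + a 1 * b 1 = 1)
include h

theorem angleForm_anglePoint (c t : AddCircle (2 * π)) : angleForm a (anglePoint a b c t) = c := by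
  have : angleForm a (anglePoint a b c t) = (a 0 * b 0 + a 1 * b 1) • c := by
    simp only [angleForm, anglePoint, Matrix.cons_val_zero, Matrix.cons_val_one, add_smul, mul_smul,
      smul_add, smul_sub]
    rw [smul_comm (a 1) (a 0) t]; abel
  rw [this, h, one_smul]

theorem angleCoord_anglePoint (c t : AddCircle (2 * π)) :
    angleCoord b (anglePoint a b c t) = t := by
  have : angleCoord b (anglePoint a b c t) = (a 0 * b 0 + a 1 * b 1) • t := by
    simp only [angleCoord, anglePoint, Matrix.cons_val_zero, Matrix.cons_val_one, add_smul, mul_smul,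
      smul_add, smul_sub]
    rw [smul_comm (b 0) (b 1) c, smul_comm (b 0) (a 0) t, smul_comm (b 1) (a 1) t]; abel
  rw [this, h, one_smul]

theorem anglePoint_angleForm (u : AngleTorus) :
    anglePoint a b (angleForm a u) (angleCoord b u) = u := by
  ext i
  fin_cases i
  · have : b 0 • angleForm a u - a 1 • angleCoord b u = (a 0 * b 0 + a 1 * b 1) • u 0 := by
      simp only [angleForm, angleCoord, add_smul, mul_smul, smul_add, smul_sub]
      rw [smul_comm (b 0) (a 0), smul_comm (b 0) (a 1)]; abel
    simpa [anglePoint, h] using this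
  · have : b 1 • angleForm a u + a 0 • angleCoord b u = (a 0 * b 0 + a 1 * b 1) • u 1 := by
      simp only [angleForm, angleCoord, add_smul, mul_smul, smul_add, smul_sub]
      rw [smul_comm (b 1) (a 0), smul_comm (b 1) (a 1)]; abel
    simpa [anglePoint, h] using this

end Coordinates

/-- The norm is a contraction from the circle onto a set containing `[0, π]`. -/
theorem hausdorffMeasure_addCircle_pos :
    0 < (Measure.hausdorffMeasure 1 : Measure (AddCircle (2 * π))) Set.univ := by
  have h1 := (lipschitzWith_one_norm (E := AddCircle (2 * π))).hausdorffMeasure_image_le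
    (d := 1) zero_le_one Set.univ
  have h2 : Set.Icc 0 π ⊆ (fun u : AddCircle (2 * π) => ‖u‖) '' Set.univ := by
    intro t ht
    refine ⟨(t : AddCircle (2 * π)), trivial, ?_⟩
    simp only
    rw [AddCircle.norm_coe_eq_abs_iff (2 * π) (by positivity) |>.mpr, abs_of_nonneg ht.1]
    rw [abs_of_nonneg ht.1, abs_of_pos Real.two_pi_pos]
    linarith [ht.2]
  have h3 : 0 < (Measure.hausdorffMeasure 1 : Measure ℝ) (Set.Icc 0 π) := by
    rw [hausdorffMeasure_real, Real.volume_Icc]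
    simp [Real.pi_pos]
  simp only [ENNReal.coe_one, ENNReal.one_rpow, one_mul] at h1
  exact h3.trans_le ((measure_mono h2).trans h1)

/-- The circle is the image of an interval under a contraction. -/
theorem hausdorffMeasure_addCircle_lt_top :
    (Measure.hausdorffMeasure 1 : Measure (AddCircle (2 * π))) Set.univ < ⊤ := by
  have hL : LipschitzWith 1 ((↑) : ℝ → AddCircle (2 * π)) := by
    refine LipschitzWith.of_dist_le_mul fun x y => ?_
    rw [dist_eq_norm, dist_eq_norm, ← AddCircle.coe_sub, NNReal.coe_one, one_mul]
    exact QuotientAddGroup.norm_mk_le_norm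
  have h1 := hL.hausdorffMeasure_image_le (d := 1) zero_le_one (Set.Icc 0 (0 + 2 * π))
  rw [AddCircle.coe_image_Icc_eq, hausdorffMeasure_real, Real.volume_Icc] at h1
  refine h1.trans_lt (ENNReal.mul_lt_top (by simp) ENNReal.ofReal_lt_top)

theorem lipschitz_angleCoord (b : Fin 2 → ℤ) : ∃ K, LipschitzWith K (angleCoord b) := by
  let f : AngleTorus →+ AddCircle (2 * π) := AddMonoidHom.mk' (angleCoord b) (angleCoord_add b)
  refine ⟨_, AddMonoidHomClass.lipschitz_of_bound f (‖b 0‖ + ‖b 1‖) fun u => ?_⟩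
  calc ‖b 0 • u 1 - b 1 • u 0‖ ≤ ‖b 0 • u 1‖ + ‖b 1 • u 0‖ := norm_sub_le _ _
    _ ≤ ‖b 0‖ * ‖u‖ + ‖b 1‖ * ‖u‖ := by
        gcongr
        · exact (norm_zsmul_le _ _).trans (by gcongr; exact PiLp.norm_apply_le u 1)
        · exact (norm_zsmul_le _ _).trans (by gcongr; exact PiLp.norm_apply_le u 0)
    _ = _ := by ring

theorem lipschitz_anglePoint (a b : Fin 2 → ℤ) : ∃ K, LipschitzWith K (anglePoint a b 0) := by
  have hL : LipschitzWith (max ‖a 1‖₊ ‖a 0‖₊)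
      (fun t : AddCircle (2 * π) => (![b 0 • 0 - a 1 • t, b 1 • 0 + a 0 • t] : Fin 2 → _)) := by
    refine LipschitzWith.of_dist_le_mul fun x y => ?_
    refine (dist_pi_le_iff (by positivity)).mpr fun i => ?_
    fin_cases i
    · simp only [Fin.zero_eta, Matrix.cons_val_zero, smul_zero, zero_sub, dist_neg_neg]
      rw [dist_eq_norm, ← smul_sub, dist_eq_norm]
      refine (norm_zsmul_le _ _).trans ?_
      gcongr
      exact_mod_cast le_max_left _ _
    · simp only [Fin.mk_one, Matrix.cons_val_one, Matrix.cons_val_fin_one, smul_zero, zero_add]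
      rw [dist_eq_norm, ← smul_sub, dist_eq_norm]
      refine (norm_zsmul_le _ _).trans ?_
      gcongr
      exact_mod_cast le_max_right _ _
  exact ⟨_, (PiLp.lipschitzWith_toLp 2 _).comp hL⟩

/-- One-dimensional Hausdorff measure on the torus of angles. -/
noncomputable abbrev lengthMeasure : Measure AngleTorus := Measure.hausdorffMeasure 1

theorem measurableSet_fiber (a : Fin 2 → ℤ) (c : AddCircle (2 * π)) :
    MeasurableSet {u | angleForm a u = c} :=
  (isClosed_singleton.preimage (continuous_angleForm a)).measurableSet

section Fibers

variable {a b : Fin 2 → ℤ} (h : a 0 * b 0 + a 1 * b 1 = 1)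
include h

theorem lengthMeasure_fiber_pos : 0 < lengthMeasure {u | angleForm a u = 0} := by
  obtain ⟨K, hK⟩ := lipschitz_angleCoord b
  have h1 := hK.hausdorffMeasure_image_le (d := 1) zero_le_one {u | angleForm a u = 0}
  have h2 : angleCoord b '' {u | angleForm a u = 0} = Set.univ :=
    Set.eq_univ_of_forall fun t =>
      ⟨anglePoint a b 0 t, angleForm_anglePoint h 0 t, angleCoord_anglePoint h 0 t⟩
  rw [h2] at h1
  have h3 := hausdorffMeasure_addCircle_pos.trans_le h1
  exact pos_of_mul_pos_right h3 zero_le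

theorem lengthMeasure_fiber_lt_top : lengthMeasure {u | angleForm a u = 0} < ⊤ := by
  obtain ⟨K, hK⟩ := lipschitz_anglePoint a b
  have h1 := hK.hausdorffMeasure_image_le (d := 1) zero_le_one Set.univ
  have h2 : {u | angleForm a u = 0} ⊆ anglePoint a b 0 '' Set.univ := fun u hu =>
    ⟨angleCoord b u, trivial, by rw [← hu]; exact anglePoint_angleForm h u⟩
  refine (measure_mono h2).trans_lt (h1.trans_lt ?_)
  exact ENNReal.mul_lt_top (by simp) hausdorffMeasure_addCircle_lt_top

/-- All fibres have the same length, being translates of one another. -/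
theorem lengthMeasure_fiber (c : AddCircle (2 * π)) :
    lengthMeasure {u | angleForm a u = c} = lengthMeasure {u | angleForm a u = 0} := by
  rw [← measure_preimage_add lengthMeasure (anglePoint a b c 0) {u | angleForm a u = c}]
  congr 1
  ext u
  simp [angleForm_add, angleForm_anglePoint h]

/-- The length measure on a fibre is a multiple of the image of Haar measure under the
parametrization of the fibre by the circle. Its image under `angleCoord b` is invariant under
translation, because translations of the torus along the fibre preserve length, so uniqueness of
Haar measure applies and the speed of the parametrization need not be computed. -/
theorem lengthMeasure_restrict_fiber (c : AddCircle (2 * π)) :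
    lengthMeasure.restrict {u | angleForm a u = c} =
      lengthMeasure {u | angleForm a u = 0} •
        AddCircle.haarAddCircle.map (anglePoint a b c) := by
  set A := {u | angleForm a u = c} with hA
  have hAm : MeasurableSet A := measurableSet_fiber a c
  have hβ := (continuous_angleCoord b).measurable
  have hΨ := (continuous_anglePoint a b c).measurable
  set ν := (lengthMeasure.restrict A).map (angleCoord b) with hν
  have hνuniv : ν Set.univ = lengthMeasure {u | angleForm a u = 0} := by
    rw [hν, Measure.map_apply hβ MeasurableSet.univ, Set.preimage_univ, Measure.restrict_apply_univ,
      lengthMeasure_fiber h]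
  have : IsFiniteMeasure ν := ⟨by rw [hνuniv]; exact lengthMeasure_fiber_lt_top h⟩
  have hinv : ν.IsAddLeftInvariant := by
    refine ⟨fun t => ?_⟩
    have hg := (measurePreserving_add_left lengthMeasure (anglePoint a b 0 t)).restrict_preimage hAm
    have hpre : (fun u => anglePoint a b 0 t + u) ⁻¹' A = A := by
      ext u
      simp [hA, angleForm_add, angleForm_anglePoint h]
    rw [hpre] at hg
    rw [hν, Measure.map_map (by fun_prop) hβ]
    conv_rhs => rw [← hg.map_eq, Measure.map_map hβ (by fun_prop)]
    congr 1
    funext u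
    simp [angleCoord_add, angleCoord_anglePoint h]
  have hsmul := Measure.isAddLeftInvariant_eq_smul ν (AddCircle.haarAddCircle (T := 2 * π))
  have hfac : (ν.addHaarScalarFactor (AddCircle.haarAddCircle (T := 2 * π)) : ENNReal) =
      lengthMeasure {u | angleForm a u = 0} := by
    rw [← hνuniv]
    conv_rhs => rw [hsmul]
    simp
  have hback : lengthMeasure.restrict A = ν.map (anglePoint a b c) := by
    rw [hν, Measure.map_map hΨ hβ]
    conv_lhs => rw [← Measure.map_id (μ := lengthMeasure.restrict A)]
    refine Measure.map_congr ((ae_restrict_iff' hAm).mpr (Eventually.of_forall fun u hu => ?_))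
    have hu' : angleForm a u = c := hu
    rw [Function.comp, ← hu', anglePoint_angleForm h]
    rfl
  rw [hback]
  conv_lhs => rw [hsmul]
  rw [← hfac, Measure.map_smul]
  rfl

/-- The right-hand sides `2π j / e` of the equations of the segments. -/
noncomputable def segmentAngle (e : ℕ) (j : (ZMod e)ˣ) : AddCircle (2 * π) :=
  ((2 * π * ((j : ZMod e).val : ℝ) / (e : ℝ) : ℝ) : AddCircle (2 * π))

omit h in
theorem segmentAngle_injective (e : ℕ) [NeZero e] : Function.Injective (segmentAngle e) := by
  intro j k hjk
  have he : (0 : ℝ) < e := by exact_mod_cast NeZero.pos e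
  have hmem : ∀ j : (ZMod e)ˣ,
      2 * π * ((j : ZMod e).val : ℝ) / (e : ℝ) ∈ Set.Ico 0 (0 + 2 * π) := by
    intro j
    have hv : ((j : ZMod e).val : ℝ) < e := by exact_mod_cast ZMod.val_lt _
    refine ⟨by positivity, ?_⟩
    rw [zero_add, div_lt_iff₀ he]
    gcongr
  have h1 := (AddCircle.coe_eq_coe_iff_of_mem_Ico (hmem j) (hmem k)).mp hjk
  rw [div_left_inj' he.ne', mul_right_inj' Real.two_pi_pos.ne'] at h1
  exact Units.ext (ZMod.val_injective e (by exact_mod_cast h1))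

omit h in
theorem segments_eq_iUnion (a : Fin 2 → ℤ) (e : ℕ) :
    segments a e = ⋃ j : (ZMod e)ˣ, {u | angleForm a u = segmentAngle e j} := by
  ext u; simp [segments, angleForm, segmentAngle]

/-- The normalized length measure on the segments, as an average of images of Haar measure on the
circle. -/
theorem segmentMeasure_eq (e : ℕ) [NeZero e] :
    segmentMeasure a e = (Fintype.card (ZMod e)ˣ : ENNReal)⁻¹ •
      ∑ j : (ZMod e)ˣ, AddCircle.haarAddCircle.map (anglePoint a b (segmentAngle e j)) := by
  set m := lengthMeasure {u | angleForm a u = 0}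
  have hm0 : m ≠ 0 := (lengthMeasure_fiber_pos h).ne'
  have hmt : m ≠ ⊤ := (lengthMeasure_fiber_lt_top h).ne
  have hdisj : Pairwise (Function.onFun Disjoint
      fun j : (ZMod e)ˣ => {u | angleForm a u = segmentAngle e j}) := by
    intro j k hjk
    refine Set.disjoint_left.mpr fun u hu hu' => hjk (segmentAngle_injective e ?_)
    exact hu.symm.trans hu'
  have hmeas : ∀ j : (ZMod e)ˣ, MeasurableSet {u | angleForm a u = segmentAngle e j} :=
    fun j => measurableSet_fiber a _
  have hr : lengthMeasure.restrict (segments a e) =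
      m • ∑ j : (ZMod e)ˣ, AddCircle.haarAddCircle.map (anglePoint a b (segmentAngle e j)) := by
    rw [segments_eq_iUnion, Measure.restrict_iUnion hdisj hmeas, Measure.sum_fintype,
      Finset.smul_sum]
    exact Finset.sum_congr rfl fun j _ => lengthMeasure_restrict_fiber h _
  have hs : lengthMeasure (segments a e) = m * Fintype.card (ZMod e)ˣ := by
    rw [segments_eq_iUnion, measure_iUnion hdisj hmeas, tsum_fintype,
      Finset.sum_congr rfl fun j _ => lengthMeasure_fiber h _]
    simp [mul_comm, m]
  rw [segmentMeasure, ProbabilityTheory.cond]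
  change (lengthMeasure (segments a e))⁻¹ • lengthMeasure.restrict (segments a e) = _
  rw [hs, hr, smul_smul, ENNReal.mul_inv (Or.inl hm0) (Or.inl hmt), mul_right_comm,
    ENNReal.inv_mul_cancel hm0 hmt, one_mul]

end Fibers

/-! ### Integration over the segments -/

theorem coe_toCircle_coe (x : ℝ) :
    (AddCircle.toCircle (x : AddCircle (2 * π)) : ℂ) = circleMap 0 1 x := by
  rw [AddCircle.toCircle_apply_mk, div_self Real.two_pi_pos.ne', one_mul, Circle.coe_exp]
  simp [circleMap]

theorem integral_haarAddCircle_toCircle (F : ℂ → ℝ) :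
    ∫ t : AddCircle (2 * π), F (AddCircle.toCircle t) ∂AddCircle.haarAddCircle =
      Real.circleAverage F 0 1 := by
  rw [AddCircle.integral_haarAddCircle, ← AddCircle.intervalIntegral_preimage (2 * π) 0, zero_add,
    Real.circleAverage]
  simp only [coe_toCircle_coe]

theorem integrable_haarAddCircle_toCircle {F : ℂ → ℝ} (hF : CircleIntegrable F 0 1)
    (hm : Measurable F) :
    Integrable (fun t : AddCircle (2 * π) => F (AddCircle.toCircle t)) AddCircle.haarAddCircle := by
  have h1 : Integrable (fun t : AddCircle (2 * π) => F (AddCircle.toCircle t)) volume := by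
    rw [← (AddCircle.measurePreserving_mk (2 * π) 0).integrable_comp]
    · rw [zero_add]
      have := (intervalIntegrable_iff_integrableOn_Ioc_of_le Real.two_pi_pos.le).mp hF
      refine this.congr (Eventually.of_forall fun x => ?_)
      simp only [Function.comp]
      exact congrArg F (coe_toCircle_coe x).symm
    · exact (hm.comp (continuous_subtype_val.comp
        AddCircle.continuous_toCircle).measurable).aestronglyMeasurable
  rw [AddCircle.volume_eq_smul_haarAddCircle] at h1
  exact (integrable_smul_measure (by simp [Real.pi_pos]) ENNReal.ofReal_ne_top).mp h1

/-- Jensen's formula for `1 - z`. -/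
theorem integral_log_norm_one_sub_toCircle :
    ∫ t : AddCircle (2 * π), Real.log ‖1 - (AddCircle.toCircle t : ℂ)‖ ∂AddCircle.haarAddCircle =
      0 := by
  rw [integral_haarAddCircle_toCircle (fun z => Real.log ‖1 - z‖)]
  simp_rw [norm_sub_rev (1 : ℂ)]
  rw [circleAverage_log_norm_sub_const_eq_posLog]
  simp

theorem integrable_log_norm_one_sub_toCircle :
    Integrable (fun t : AddCircle (2 * π) => Real.log ‖1 - (AddCircle.toCircle t : ℂ)‖)
      AddCircle.haarAddCircle := by
  refine integrable_haarAddCircle_toCircle (F := fun z => Real.log ‖1 - z‖) ?_ (by fun_prop)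
  exact MeromorphicOn.circleIntegrable_log_norm (f := fun z => 1 - z) fun z _ => by fun_prop

theorem ae_toCircle_ne_one :
    ∀ᵐ t : AddCircle (2 * π) ∂AddCircle.haarAddCircle, ‖1 - (AddCircle.toCircle t : ℂ)‖ ≠ 0 := by
  have : ∀ᵐ t : AddCircle (2 * π) ∂AddCircle.haarAddCircle, t ≠ 0 := by
    have h1 : ∀ᵐ t : AddCircle (2 * π) ∂volume, t ≠ 0 := by
      rw [ae_iff]
      simp only [ne_eq, not_not, Set.ofPred_eq_eq_singleton]
      have := AddCircle.volume_closedBall (2 * π) (x := 0) 0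
      simpa using this
    rw [AddCircle.volume_eq_smul_haarAddCircle] at h1
    exact (Measure.ae_ennreal_smul_measure_iff (by simp [Real.pi_pos])).mp h1
  filter_upwards [this] with t ht
  rw [norm_ne_zero_iff, sub_ne_zero]
  intro h
  apply ht
  apply AddCircle.injective_toCircle Real.two_pi_pos.ne'
  rw [AddCircle.toCircle_zero]
  exact Circle.ext (by simpa using h.symm)

instance compactSpace_angleTorus : CompactSpace AngleTorus := by
  have : Function.Surjective (WithLp.toLp 2 : (Fin 2 → AddCircle (2 * π)) → AngleTorus) :=
    fun u => ⟨u.ofLp, rfl⟩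
  exact this.compactSpace (PiLp.continuous_toLp 2 _)

/-- The character `u ↦ exp (i (m₁ u₁ + m₂ u₂))` of the torus of angles. -/
noncomputable def angleChar (m : Fin 2 → ℤ) : C(AngleTorus, ℂ) where
  toFun u := fourier (m 0) (u 0) * fourier (m 1) (u 1)
  continuous_toFun := ((map_continuous (fourier (m 0))).comp (continuous_apply_angle 0)).mul
    ((map_continuous (fourier (m 1))).comp (continuous_apply_angle 1))

theorem angleChar_apply (m : Fin 2 → ℤ) (u : AngleTorus) :
    angleChar m u = (AddCircle.toCircle (u 0) : ℂ) ^ m 0 * (AddCircle.toCircle (u 1) : ℂ) ^ m 1 := by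
  simp [angleChar, fourier_apply, AddCircle.toCircle_zsmul]

theorem angleChar_zero : angleChar 0 = 1 := by ext u; simp [angleChar_apply]

theorem angleChar_add (m n : Fin 2 → ℤ) : angleChar (m + n) = angleChar m * angleChar n := by
  ext u
  simp only [angleChar, ContinuousMap.coe_mk, Pi.add_apply, fourier_add, ContinuousMap.mul_apply]
  ring

theorem star_angleChar (m : Fin 2 → ℤ) : star (angleChar m) = angleChar (-m) := by
  ext u
  simp [angleChar]

/-- The characters span a dense subspace of the continuous functions. -/
theorem span_angleChar_topologicalClosure :
    (Submodule.span ℂ (Set.range angleChar)).topologicalClosure = ⊤ := by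
  let A : StarSubalgebra ℂ C(AngleTorus, ℂ) :=
    { Algebra.adjoin ℂ (Set.range angleChar) with
      star_mem' := by
        change Algebra.adjoin ℂ (Set.range angleChar) ≤
          star (Algebra.adjoin ℂ (Set.range angleChar))
        refine Algebra.adjoin_le ?_
        rintro _ ⟨n, rfl⟩
        refine Algebra.subset_adjoin ⟨-n, ?_⟩
        rw [← star_angleChar] }
  have hA : A.toSubalgebra.toSubmodule = Submodule.span ℂ (Set.range angleChar) := by
    apply Algebra.adjoin_eq_span_of_subset
    refine Set.Subset.trans (fun x => Submonoid.closure_induction (fun _ => id) ⟨0, ?_⟩ ?_)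
      Submodule.subset_span
    · exact angleChar_zero
    · rintro _ _ _ _ ⟨m, rfl⟩ ⟨n, rfl⟩
      exact ⟨m + n, angleChar_add m n⟩
  have hsep : A.SeparatesPoints := by
    intro u v huv
    obtain ⟨i, hi⟩ : ∃ i, u i ≠ v i := by
      by_contra! hcon
      exact huv (PiLp.ext hcon)
    refine ⟨_, ⟨angleChar (Pi.single i 1), Algebra.subset_adjoin ⟨Pi.single i 1, rfl⟩, rfl⟩, ?_⟩
    contrapose! hi
    apply AddCircle.injective_toCircle Real.two_pi_pos.ne'
    apply Circle.ext
    fin_cases i <;> simpa [angleChar_apply] using hi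
  rw [← hA]
  exact congrArg (fun B : StarSubalgebra ℂ C(AngleTorus, ℂ) => B.toSubalgebra.toSubmodule)
    (ContinuousMap.starSubalgebra_topologicalClosure_eq_top_of_separatesPoints A hsep)

section SegmentIntegrals

variable {a b : Fin 2 → ℤ} (h : a 0 * b 0 + a 1 * b 1 = 1) {e : ℕ} [NeZero e]
include h

theorem isProbabilityMeasure_segmentMeasure : IsProbabilityMeasure (segmentMeasure a e) := by
  refine ⟨?_⟩
  have : ∀ j : (ZMod e)ˣ, (AddCircle.haarAddCircle.map
      (anglePoint a b (segmentAngle e j))) Set.univ = 1 := fun j => by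
    rw [Measure.map_apply (continuous_anglePoint a b _).measurable MeasurableSet.univ]
    simp
  rw [segmentMeasure_eq h, Measure.smul_apply, Measure.finsetSum_apply]
  simp only [this, Finset.sum_const, Finset.card_univ, nsmul_eq_mul, mul_one, smul_eq_mul]
  exact ENNReal.inv_mul_cancel (by exact_mod_cast Fintype.card_ne_zero)
    (ENNReal.natCast_ne_top _)

/-- The completing coordinate is uniformly distributed with respect to the normalized length
measure. -/
theorem map_angleCoord_segmentMeasure :
    (segmentMeasure a e).map (angleCoord b) = AddCircle.haarAddCircle := by
  have : ∀ j : (ZMod e)ˣ, (AddCircle.haarAddCircle.map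
      (anglePoint a b (segmentAngle e j))).map (angleCoord b) = AddCircle.haarAddCircle := fun j => by
    rw [Measure.map_map (continuous_angleCoord b).measurable
      (continuous_anglePoint a b _).measurable]
    conv_rhs => rw [← Measure.map_id (μ := AddCircle.haarAddCircle)]
    congr 1
    funext t
    exact angleCoord_anglePoint h _ t
  rw [segmentMeasure_eq h, Measure.map_smul,
    Measure.map_finset_sum' (continuous_angleCoord b).measurable.aemeasurable]
  simp only [this, Finset.sum_const, Finset.card_univ]
  rw [← Nat.cast_smul_eq_nsmul ENNReal, smul_smul,
    ENNReal.inv_mul_cancel (by exact_mod_cast Fintype.card_ne_zero) (ENNReal.natCast_ne_top _),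
    one_smul]

theorem integral_segmentMeasure_continuous (f : C(AngleTorus, ℂ)) :
    ∫ u, f u ∂(segmentMeasure a e) = 𝔼 j : (ZMod e)ˣ,
      ∫ t, f (anglePoint a b (segmentAngle e j) t) ∂AddCircle.haarAddCircle := by
  have hprob : ∀ j : (ZMod e)ˣ, IsProbabilityMeasure (AddCircle.haarAddCircle.map
      (anglePoint a b (segmentAngle e j))) := fun j =>
    Measure.isProbabilityMeasure_map (continuous_anglePoint a b _).measurable.aemeasurable
  rw [segmentMeasure_eq h, integral_smul_measure,
    integral_finsetSum_measure fun j _ => continuousMap_integrable f,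
    Fintype.expect_eq_sum_div_card, div_eq_inv_mul]
  simp only [integral_map (continuous_anglePoint a b _).measurable.aemeasurable
    f.continuous.aestronglyMeasurable]
  simp

omit h in
theorem angleChar_anglePoint (m : Fin 2 → ℤ) (c t : AddCircle (2 * π)) :
    angleChar m (anglePoint a b c t) =
      fourier (b 0 * m 0 + b 1 * m 1) c * fourier (a 0 * m 1 - a 1 * m 0) t := by
  have hc : (AddCircle.toCircle c : ℂ) ≠ 0 := Circle.coe_ne_zero _
  have ht : (AddCircle.toCircle t : ℂ) ≠ 0 := Circle.coe_ne_zero _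
  simp only [angleChar_apply, anglePoint, Matrix.cons_val_zero, Matrix.cons_val_one,
    Matrix.cons_val_fin_one, sub_eq_add_neg, AddCircle.toCircle_add, AddCircle.toCircle_neg,
    AddCircle.toCircle_zsmul, fourier_apply, Circle.coe_mul, Circle.coe_inv, Circle.coe_zpow,
    mul_zpow, zpow_add₀ hc, zpow_add₀ ht, zpow_neg, inv_zpow, zpow_mul]
  ring

omit h in
/-- The points `exp (2π i j / e)` for units `j` modulo `e` are the primitive `e`-th roots of unity.
-/
theorem expect_segmentAngle (r : ℤ) :
    𝔼 j : (ZMod e)ˣ, fourier r (segmentAngle e j) = 𝔼 z ∈ primitiveRoots e ℂ, z ^ r := by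
  have he : e ≠ 0 := NeZero.ne e
  have hval : ∀ j : (ZMod e)ˣ, (AddCircle.toCircle (segmentAngle e j) : ℂ) =
      Complex.exp (2 * π * Complex.I * (((j : ZMod e).val : ℂ) / (e : ℂ))) := by
    intro j
    rw [segmentAngle, coe_toCircle_coe, circleMap]
    simp only [zero_add, Complex.ofReal_one, one_mul]
    congr 1
    push_cast
    ring
  refine Finset.expect_nbij (fun j => (AddCircle.toCircle (segmentAngle e j) : ℂ)) ?_ ?_ ?_ ?_
  · intro j _
    rw [mem_primitiveRoots (NeZero.pos e), Complex.isPrimitiveRoot_iff _ _ he]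
    exact ⟨(j : ZMod e).val, ZMod.val_lt _, ZMod.val_coe_unit_coprime j, (hval j).symm⟩
  · intro j _
    rw [fourier_apply, AddCircle.toCircle_zsmul, Circle.coe_zpow]
  · intro j _ k _ hjk
    exact segmentAngle_injective e
      (AddCircle.injective_toCircle Real.two_pi_pos.ne' (Circle.ext hjk))
  · intro z hz
    rw [Finset.mem_coe, mem_primitiveRoots (NeZero.pos e),
      Complex.isPrimitiveRoot_iff _ _ he] at hz
    obtain ⟨i, hi, hcop, rfl⟩ := hz
    refine ⟨ZMod.unitOfCoprime i hcop, Finset.mem_coe.mpr (Finset.mem_univ _), ?_⟩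
    simp only [hval, ZMod.coe_unitOfCoprime, ZMod.val_natCast, Nat.mod_eq_of_lt hi]

omit h in
theorem integral_fourier_haarAddCircle (n : ℤ) :
    ∫ t : AddCircle (2 * π), fourier n t ∂AddCircle.haarAddCircle = if n = 0 then 1 else 0 := by
  have := congrFun (fourierCoeff_fourier (T := 2 * π) n) 0
  simpa [fourierCoeff, Pi.single_apply, eq_comm] using this

/-- A character is constant along each segment if it is a power of `χ^a`, and otherwise its integral
over each segment is `0`. -/
theorem integral_angleChar (m : Fin 2 → ℤ) :
    ∫ u, angleChar m u ∂(segmentMeasure a e) =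
      if a 0 * m 1 - a 1 * m 0 = 0 then
        𝔼 z ∈ primitiveRoots e ℂ, z ^ (b 0 * m 0 + b 1 * m 1) else 0 := by
  rw [integral_segmentMeasure_continuous h]
  simp only [angleChar_anglePoint, integral_const_mul, integral_fourier_haarAddCircle]
  split_ifs
  · simp only [mul_one]
    exact expect_segmentAngle _
  · simp

end SegmentIntegrals

/-! ### The Mahler measure of `1 + x + y` -/

/-- Termwise integration of the Taylor series of the logarithm, inside the unit disc. -/
theorem hasSum_integral_log_norm_one_add {r : ℝ} (hr0 : 0 ≤ r) (hr1 : r < 1) (α : ℝ) :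
    HasSum (fun n : ℕ => (-1) ^ (n + 1) * r ^ n * Real.sin (n * α) / (n : ℝ) ^ 2)
      (∫ t in (0 : ℝ)..α, Real.log ‖1 + (r : ℂ) * Complex.exp (t * Complex.I)‖) := by
  have hnorm : ∀ t : ℝ, ‖(r : ℂ) * Complex.exp (t * Complex.I)‖ = r := fun t => by
    rw [norm_mul, Complex.norm_exp_ofReal_mul_I, mul_one, Complex.norm_of_nonneg hr0]
  have hpt : ∀ t : ℝ, HasSum (fun n : ℕ => (-1) ^ (n + 1) * r ^ n * Real.cos (n * t) / n)
      (Real.log ‖1 + (r : ℂ) * Complex.exp (t * Complex.I)‖) := by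
    intro t
    have h1 := Complex.hasSum_re (Complex.hasSum_taylorSeries_log (by rw [hnorm t]; exact hr1))
    rw [Complex.log_re] at h1
    refine h1.congr_fun fun n => ?_
    have : (-1 : ℂ) ^ (n + 1) * ((r : ℂ) * Complex.exp (t * Complex.I)) ^ n / n =
        (((-1) ^ (n + 1) * r ^ n / n : ℝ) : ℂ) * Complex.exp ((n * t : ℝ) * Complex.I) := by
      rw [mul_pow, ← Complex.exp_nat_mul]
      push_cast
      rw [← mul_assoc (n : ℂ)]
      ring
    rw [this, Complex.re_ofReal_mul, Complex.exp_ofReal_mul_I_re]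
    ring
  have h := intervalIntegral.hasSum_integral_of_dominated_convergence (μ := volume) (a := 0)
    (b := α) (F := fun (n : ℕ) t => (-1) ^ (n + 1) * r ^ n * Real.cos (n * t) / n)
    (f := fun t => Real.log ‖1 + (r : ℂ) * Complex.exp (t * Complex.I)‖) (fun n _ => r ^ n)
    (fun n => by
      refine Continuous.aestronglyMeasurable ?_
      fun_prop)
    (fun n => Eventually.of_forall fun t _ => by
      rw [norm_div, norm_mul, norm_mul, norm_pow, norm_neg, norm_one, one_pow, one_mul, norm_pow,
        Real.norm_of_nonneg hr0, Real.norm_natCast]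
      have hc : ‖Real.cos (n * t)‖ ≤ 1 := Real.abs_cos_le_one _
      have hp : 0 ≤ r ^ n := by positivity
      rcases Nat.eq_zero_or_pos n with rfl | hn
      · simp
      · have hn1 : (1 : ℝ) ≤ n := by exact_mod_cast hn
        rw [div_le_iff₀ (by positivity)]
        nlinarith [mul_le_mul_of_nonneg_left hc hp, mul_le_mul_of_nonneg_left hn1 hp])
    (Eventually.of_forall fun t _ => summable_geometric_of_lt_one hr0 hr1)
    (by simp) (Eventually.of_forall fun t _ => hpt t)
  refine h.congr_fun fun n => ?_
  rcases Nat.eq_zero_or_pos n with rfl | hn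
  · simp
  have hn0 : (n : ℝ) ≠ 0 := by exact_mod_cast hn.ne'
  have : ∀ t : ℝ, (-1) ^ (n + 1) * r ^ n * Real.cos (n * t) / n =
      ((-1) ^ (n + 1) * r ^ n / n) * Real.cos (n * t) := fun t => by ring
  simp only [this]
  rw [intervalIntegral.integral_const_mul, intervalIntegral.integral_comp_mul_left _ hn0,
    integral_cos]
  simp only [mul_zero, Real.sin_zero, sub_zero, smul_eq_mul]
  field_simp

theorem normSq_one_add_mul_exp (r t : ℝ) :
    ‖1 + (r : ℂ) * Complex.exp (t * Complex.I)‖ ^ 2 = 1 + 2 * r * Real.cos t + r ^ 2 := by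
  rw [← Complex.normSq_eq_norm_sq, Complex.normSq_apply]
  simp only [Complex.add_re, Complex.one_re, Complex.re_ofReal_mul, Complex.exp_ofReal_mul_I_re,
    Complex.add_im, Complex.one_im, Complex.im_ofReal_mul, Complex.exp_ofReal_mul_I_im]
  linear_combination r ^ 2 * Real.cos_sq_add_sin_sq t

theorem neg_half_le_cos {t : ℝ} (h0 : 0 ≤ t) (h1 : t ≤ 2 * π / 3) : -(1 / 2) ≤ Real.cos t := by
  have h2 : Real.cos (2 * π / 3) = -(1 / 2) := by
    rw [show 2 * π / 3 = π - π / 3 by ring, Real.cos_pi_sub, Real.cos_pi_div_three]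
  rw [← h2]
  exact Real.cos_le_cos_of_nonneg_of_le_pi h0 (by linarith [Real.pi_pos]) h1

/-- The limit `r → 1` of the corresponding identity inside the unit disc. On the range of
integration `1 + r * exp (i t)` stays away from `0`, and the series is dominated by `∑ 1 / n ^ 2`.
-/
theorem integral_log_norm_one_add_exp :
    ∫ t in (0 : ℝ)..(2 * π / 3), Real.log ‖1 + Complex.exp (t * Complex.I)‖ =
      ∑' n : ℕ, (-1) ^ (n + 1) * Real.sin (n * (2 * π / 3)) / (n : ℝ) ^ 2 := by
  have hα : (0 : ℝ) ≤ 2 * π / 3 := by positivity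
  have hev : ∀ᶠ r : ℝ in 𝓝[<] 1, 0 ≤ r ∧ r < 1 := by
    filter_upwards [self_mem_nhdsWithin, mem_nhdsWithin_of_mem_nhds (lt_mem_nhds zero_lt_one)]
      with r h1 h0
    exact ⟨h0.le, h1⟩
  have hlow : ∀ r t : ℝ, 0 ≤ r → t ∈ Set.uIoc 0 (2 * π / 3) →
      1 / 2 ≤ ‖1 + (r : ℂ) * Complex.exp (t * Complex.I)‖ := by
    intro r t hr ht
    rw [Set.uIoc_of_le hα] at ht
    have h1 := neg_half_le_cos ht.1.le ht.2
    have h2 := normSq_one_add_mul_exp r t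
    refine le_of_sq_le_sq ?_ (norm_nonneg _)
    rw [h2]
    nlinarith [sq_nonneg (r - 1 / 2)]
  have hleft : Tendsto (fun r : ℝ => ∫ t in (0 : ℝ)..(2 * π / 3),
      Real.log ‖1 + (r : ℂ) * Complex.exp (t * Complex.I)‖) (𝓝[<] 1)
      (𝓝 (∫ t in (0 : ℝ)..(2 * π / 3), Real.log ‖1 + Complex.exp (t * Complex.I)‖)) := by
    refine intervalIntegral.tendsto_integral_filter_of_dominated_convergence
      (fun _ => Real.log 2) ?_ ?_ (by simp) ?_
    · refine Eventually.of_forall fun r => Measurable.aestronglyMeasurable ?_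
      fun_prop
    · filter_upwards [hev] with r hr
      refine Eventually.of_forall fun t ht => ?_
      have h1 := hlow r t hr.1 ht
      have h2 : ‖1 + (r : ℂ) * Complex.exp (t * Complex.I)‖ ≤ 2 := by
        refine (norm_add_le _ _).trans ?_
        rw [norm_one, norm_mul, Complex.norm_exp_ofReal_mul_I, Complex.norm_of_nonneg hr.1]
        linarith [hr.2]
      rw [Real.norm_eq_abs, abs_le, ← Real.log_inv]
      constructor
      · exact Real.log_le_log (by norm_num) (by linarith)
      · exact Real.log_le_log (by linarith) h2
    · refine Eventually.of_forall fun t ht => ?_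
      have h1 := hlow 1 t zero_le_one ht
      have hc : Continuous fun r : ℝ => ‖1 + (r : ℂ) * Complex.exp (t * Complex.I)‖ := by fun_prop
      have := ((hc.tendsto 1).log (by linarith)).mono_left (nhdsWithin_le_nhds (s := Set.Iio 1))
      simpa using this
  have hright : Tendsto (fun r : ℝ => ∑' n : ℕ,
      (-1) ^ (n + 1) * r ^ n * Real.sin (n * (2 * π / 3)) / (n : ℝ) ^ 2) (𝓝[<] 1)
      (𝓝 (∑' n : ℕ, (-1) ^ (n + 1) * Real.sin (n * (2 * π / 3)) / (n : ℝ) ^ 2)) := by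
    refine tendsto_tsum_of_dominated_convergence (bound := fun n : ℕ => 1 / (n : ℝ) ^ 2)
      (Real.summable_one_div_nat_pow.mpr one_lt_two) ?_ ?_
    · intro n
      have hc : Continuous fun r : ℝ =>
          (-1) ^ (n + 1) * r ^ n * Real.sin (n * (2 * π / 3)) / (n : ℝ) ^ 2 := by fun_prop
      simpa using (hc.tendsto 1).mono_left (nhdsWithin_le_nhds (s := Set.Iio 1))
    · filter_upwards [hev] with r hr n
      rw [norm_div, norm_mul, norm_mul, norm_pow, norm_neg, norm_one, one_pow, one_mul, norm_pow,
        Real.norm_of_nonneg hr.1, norm_pow, Real.norm_natCast]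
      gcongr
      exact mul_le_one₀ (pow_le_one₀ hr.1 hr.2.le) (norm_nonneg _) (Real.abs_sin_le_one _)
  refine tendsto_nhds_unique hleft (hright.congr' ?_)
  filter_upwards [hev] with r hr
  exact (hasSum_integral_log_norm_one_add hr.1 hr.2 _).tsum_eq

/-- On the upper half circle `|1 + exp (i t)| ≥ 1` holds exactly for `t ≤ 2π / 3`. -/
theorem circleAverage_posLog_norm_one_add :
    Real.circleAverage (fun z => log⁺ ‖1 + z‖) 0 1 =
      π⁻¹ * ∫ t in (0 : ℝ)..(2 * π / 3), Real.log ‖1 + Complex.exp (t * Complex.I)‖ := by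
  set F : ℝ → ℝ := fun t => log⁺ ‖1 + Complex.exp (t * Complex.I)‖ with hF
  have hFc : Continuous F := Real.continuous_posLog.comp (by fun_prop)
  have hint : ∀ x y : ℝ, IntervalIntegrable F volume x y := fun x y => hFc.intervalIntegrable x y
  have hsq : ∀ t : ℝ, ‖1 + Complex.exp (t * Complex.I)‖ ^ 2 = 2 + 2 * Real.cos t := fun t => by
    have := normSq_one_add_mul_exp 1 t
    rw [Complex.ofReal_one, one_mul] at this
    rw [this]; ring
  have hsymm : ∀ t, F (2 * π - t) = F t := by
    intro t
    have : ‖1 + Complex.exp ((2 * π - t : ℝ) * Complex.I)‖ = ‖1 + Complex.exp (t * Complex.I)‖ := by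
      rw [← sq_eq_sq₀ (norm_nonneg _) (norm_nonneg _), hsq, hsq, Real.cos_two_pi_sub]
    simp only [hF, this]
  have h1 : ∫ t in (0 : ℝ)..(2 * π), F t = 2 * ∫ t in (0 : ℝ)..π, F t := by
    rw [← intervalIntegral.integral_add_adjacent_intervals (hint 0 π) (hint π (2 * π))]
    have := intervalIntegral.integral_comp_sub_left (a := 0) (b := π) F (2 * π)
    simp only [hsymm] at this
    rw [this, sub_zero, show 2 * π - π = π by ring]
    ring
  have h2 : ∫ t in (2 * π / 3)..π, F t = 0 := by
    rw [intervalIntegral.integral_congr (g := fun _ => (0 : ℝ))]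
    · simp
    · intro t ht
      rw [Set.uIcc_of_le (by linarith [Real.pi_pos])] at ht
      have hcos : Real.cos t ≤ -(1 / 2) := by
        have h2 : Real.cos (2 * π / 3) = -(1 / 2) := by
          rw [show 2 * π / 3 = π - π / 3 by ring, Real.cos_pi_sub, Real.cos_pi_div_three]
        rw [← h2]
        exact Real.cos_le_cos_of_nonneg_of_le_pi (by positivity) ht.2 ht.1
      simp only [hF]
      rw [Real.posLog_eq_zero_iff, abs_of_nonneg (norm_nonneg _),
        ← sq_le_one_iff₀ (norm_nonneg _), hsq]
      linarith
  have h3 : ∫ t in (0 : ℝ)..(2 * π / 3), F t =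
      ∫ t in (0 : ℝ)..(2 * π / 3), Real.log ‖1 + Complex.exp (t * Complex.I)‖ := by
    refine intervalIntegral.integral_congr fun t ht => ?_
    rw [Set.uIcc_of_le (by positivity)] at ht
    have hcos := neg_half_le_cos ht.1 ht.2
    simp only [hF]
    refine Real.posLog_eq_log ?_
    rw [abs_of_nonneg (norm_nonneg _), ← one_le_sq_iff₀ (norm_nonneg _), hsq]
    linarith
  have h4 : ∫ t in (0 : ℝ)..π, F t = ∫ t in (0 : ℝ)..(2 * π / 3), F t := by
    rw [← intervalIntegral.integral_add_adjacent_intervals (hint 0 (2 * π / 3)) (hint _ π), h2,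
      add_zero]
  have hcm : ∀ t : ℝ, log⁺ ‖1 + circleMap 0 1 t‖ = F t := fun t => by simp [hF, circleMap]
  rw [Real.circleAverage]
  simp only [hcm]
  rw [h1, h4, h3, smul_eq_mul, mul_inv]
  ring

/-! ### The value of the `L`-series -/

/-- The odd Dirichlet character modulo `3` with values in the reals. -/
noncomputable def realChi (n : ℕ) : ℝ := if n % 3 = 1 then 1 else if n % 3 = 2 then -1 else 0

theorem chiNegThree_natCast (n : ℕ) : chiNegThree (n : ZMod 3) = (realChi n : ℂ) := by
  have h : ∀ x : ZMod 3, quadraticChar (ZMod 3) x = if x = 1 then 1 else if x = 2 then -1 else 0 := by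
    decide
  have hlt : n % 3 < 3 := Nat.mod_lt _ (by norm_num)
  have hv : chiNegThree (n : ZMod 3) = ((quadraticChar (ZMod 3) ((n % 3 : ℕ) : ZMod 3) : ℤ) : ℂ) := by
    rw [ZMod.natCast_mod]; rfl
  rw [hv, h, realChi]
  interval_cases n % 3
  · rw [if_neg (by decide), if_neg (by decide)]; simp
  · simp
  · rw [if_neg (by decide), if_pos (by decide)]; simp

theorem sin_two_pi_div_three (n : ℕ) : Real.sin (n * (2 * π / 3)) = √3 / 2 * realChi n := by
  have h3 : Real.sin (π / 3) = √3 / 2 := Real.sin_pi_div_three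
  have hr : (n : ℝ) = 3 * (n / 3 : ℕ) + (n % 3 : ℕ) := by exact_mod_cast (Nat.div_add_mod n 3).symm
  have h : Real.sin (n * (2 * π / 3)) = Real.sin ((n % 3 : ℕ) * (2 * π / 3)) := by
    rw [hr, show (3 * ((n / 3 : ℕ) : ℝ) + ((n % 3 : ℕ) : ℝ)) * (2 * π / 3) =
      ((n % 3 : ℕ) : ℝ) * (2 * π / 3) + ((n / 3 : ℕ) : ℝ) * (2 * π) by ring,
      Real.sin_add_nat_mul_two_pi]
  have hlt : n % 3 < 3 := Nat.mod_lt _ (by norm_num)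
  rw [h, realChi]
  interval_cases hn : n % 3
  · simp
  · simp only [Nat.cast_one, one_mul, if_true, mul_one]
    rw [show 2 * π / 3 = π - π / 3 by ring, Real.sin_pi_sub, h3]
  · rw [show ((2 : ℕ) : ℝ) * (2 * π / 3) = π / 3 + π by push_cast; ring, Real.sin_add_pi, h3]
    simp

theorem LFunction_chiNegThree_two :
    DirichletCharacter.LFunction chiNegThree 2 = ((∑' n : ℕ, realChi n / (n : ℝ) ^ 2 : ℝ) : ℂ) := by
  rw [DirichletCharacter.LFunction_eq_LSeries _ (by norm_num), LSeries, Complex.ofReal_tsum]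
  refine tsum_congr fun n => ?_
  rw [LSeries.term_def]
  split_ifs with hn
  · simp [hn]
  · rw [chiNegThree_natCast]
    push_cast
    norm_num

theorem summable_realChi : Summable fun n : ℕ => realChi n / (n : ℝ) ^ 2 := by
  refine Summable.of_norm_bounded (Real.summable_one_div_nat_pow.mpr one_lt_two) fun n => ?_
  rw [norm_div, norm_pow, Real.norm_natCast]
  gcongr
  rw [realChi]
  split_ifs <;> simp

/-- The terms with even index contribute `χ(2) / 4 = -1 / 4` times the whole series. -/
theorem tsum_alternating_realChi :
    ∑' n : ℕ, (-1) ^ (n + 1) * realChi n / (n : ℝ) ^ 2 =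
      3 / 2 * ∑' n : ℕ, realChi n / (n : ℝ) ^ 2 := by
  set L := ∑' n : ℕ, realChi n / (n : ℝ) ^ 2
  have hL : HasSum (fun n : ℕ => realChi n / (n : ℝ) ^ 2) L := summable_realChi.hasSum
  have heven : HasSum (fun n : ℕ => if Even n then realChi n / (n : ℝ) ^ 2 else 0) (-(1 / 4) * L) := by
    rw [← (mul_right_injective₀ (two_ne_zero' ℕ)).hasSum_iff]
    · refine (hL.mul_left (-(1 / 4))).congr_fun fun n => ?_
      have : realChi (2 * n) = -realChi n := by
        have hlt : n % 3 < 3 := Nat.mod_lt _ (by norm_num)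
        rw [realChi, realChi, Nat.mul_mod]
        interval_cases n % 3 <;> simp
      simp only [Function.comp, even_two_mul, if_true, this]
      push_cast
      ring
    · intro n hn
      rw [if_neg]
      rintro ⟨k, rfl⟩
      exact hn ⟨k, by ring⟩
  -- subtracting the even part twice changes the sign of the terms with even index
  have := hL.sub (heven.mul_left 2)
  rw [show 3 / 2 * L = L - 2 * (-(1 / 4) * L) by ring]
  refine (this.congr_fun fun n => ?_).tsum_eq
  by_cases hn : Even n
  · rw [if_pos hn, hn.add_one.neg_one_pow]; ring
  · rw [if_neg hn, (Nat.not_even_iff_odd.mp hn).add_one.neg_one_pow]; ring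

/-- Smyth's evaluation of the Mahler measure of `1 + x + y`. -/
theorem circleAverage_posLog_eq_LFunction :
    ((Real.circleAverage (fun z => log⁺ ‖1 + z‖) 0 1 : ℝ) : ℂ) =
      3 * (√3 : ℝ) / (4 * (π : ℝ)) * DirichletCharacter.LFunction chiNegThree 2 := by
  have h : Real.circleAverage (fun z => log⁺ ‖1 + z‖) 0 1 =
      3 * √3 / (4 * π) * ∑' n : ℕ, realChi n / (n : ℝ) ^ 2 := by
    rw [circleAverage_posLog_norm_one_add, integral_log_norm_one_add_exp]
    have : ∀ n : ℕ, (-1) ^ (n + 1) * Real.sin (n * (2 * π / 3)) / (n : ℝ) ^ 2 =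
        √3 / 2 * ((-1) ^ (n + 1) * realChi n / (n : ℝ) ^ 2) := fun n => by
      rw [sin_two_pi_div_three]; ring
    simp only [this]
    rw [tsum_mul_left, tsum_alternating_realChi]
    field_simp
    ring
  rw [h, LFunction_chiNegThree_two]
  push_cast
  ring

/-! ### The logarithmic singularity -/

theorem norm_one_sub_zpow_le (z : Circle) (n : ℤ) : ‖1 - (z : ℂ) ^ n‖ ≤ |(n : ℝ)| * ‖1 - (z : ℂ)‖ := by
  have hnat : ∀ k : ℕ, ‖1 - (z : ℂ) ^ k‖ ≤ k * ‖1 - (z : ℂ)‖ := by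
    intro k
    induction k with
    | zero => simp
    | succ k ih =>
      have : 1 - (z : ℂ) ^ (k + 1) = (1 - (z : ℂ) ^ k) + (z : ℂ) ^ k * (1 - z) := by ring
      rw [this]
      refine (norm_add_le _ _).trans ?_
      rw [norm_mul, norm_pow, Circle.norm_coe, one_pow, one_mul]
      push_cast
      linarith
  rcases Int.natAbs_eq n with h | h
  · rw [h, zpow_natCast]
    simpa using hnat n.natAbs
  · rw [h, zpow_neg, zpow_natCast]
    have hz : (z : ℂ) ^ n.natAbs ≠ 0 := pow_ne_zero _ (Circle.coe_ne_zero z)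
    have : 1 - ((z : ℂ) ^ n.natAbs)⁻¹ = -(((z : ℂ) ^ n.natAbs)⁻¹ * (1 - (z : ℂ) ^ n.natAbs)) := by
      field_simp
      ring
    rw [this, norm_neg, norm_mul, norm_inv, norm_pow, Circle.norm_coe]
    simpa using hnat n.natAbs

theorem norm_one_sub_mul_le {x y : ℂ} (hx : ‖x‖ = 1) : ‖1 - x * y‖ ≤ ‖1 - x‖ + ‖1 - y‖ := by
  have : 1 - x * y = (1 - x) + x * (1 - y) := by ring
  rw [this]
  refine (norm_add_le _ _).trans ?_
  rw [norm_mul, hx, one_mul]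

theorem continuous_expI (i : Fin 2) : Continuous fun u : AngleTorus => expI (u i) :=
  continuous_subtype_val.comp (AddCircle.continuous_toCircle.comp (continuous_apply_angle i))

/-- The function whose logarithm is `logMax`. -/
noncomputable def maxDist : C(AngleTorus, ℝ) where
  toFun u := max ‖expI (u 1) - expI (u 0)‖ (max ‖expI (u 1) - 1‖ ‖expI (u 0) - 1‖)
  continuous_toFun := by
    have h0 := continuous_expI 0
    have h1 := continuous_expI 1
    fun_prop

/-- The distance between `1` and the character completing `χ^a` to a basis of the characters. -/
noncomputable def coordDist (b : Fin 2 → ℤ) : C(AngleTorus, ℝ) where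
  toFun u := ‖1 - angleChar ![-b 1, b 0] u‖
  continuous_toFun := by fun_prop

theorem coordDist_eq (b : Fin 2 → ℤ) (u : AngleTorus) :
    coordDist b u = ‖1 - (AddCircle.toCircle (angleCoord b u) : ℂ)‖ := by
  simp only [coordDist, ContinuousMap.coe_mk, angleChar_apply, angleCoord, sub_eq_add_neg,
    AddCircle.toCircle_add, AddCircle.toCircle_neg, AddCircle.toCircle_zsmul, Circle.coe_mul,
    Circle.coe_inv, Circle.coe_zpow, Matrix.cons_val_zero, Matrix.cons_val_one,
    Matrix.cons_val_fin_one, zpow_neg]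
  rw [mul_comm]

theorem coordDist_nonneg (b : Fin 2 → ℤ) (u : AngleTorus) : 0 ≤ coordDist b u := by
  rw [coordDist_eq]; positivity

/-- The singularities of the logarithm of `maxDist` are no worse than those of the logarithm of
`coordDist b`. -/
theorem coordDist_le (b : Fin 2 → ℤ) (u : AngleTorus) :
    coordDist b u ≤ (|(b 0 : ℝ)| + |(b 1 : ℝ)|) * maxDist u := by
  have h0 : ‖1 - expI (u 0)‖ ≤ maxDist u := by
    rw [norm_sub_rev]; exact (le_max_right _ _).trans (le_max_right _ _)
  have h1 : ‖1 - expI (u 1)‖ ≤ maxDist u := by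
    rw [norm_sub_rev]; exact (le_max_left _ _).trans (le_max_right _ _)
  change ‖1 - angleChar ![-b 1, b 0] u‖ ≤ _
  rw [angleChar_apply]
  refine (norm_one_sub_mul_le ?_).trans ?_
  · rw [norm_zpow, Circle.norm_coe, one_zpow]
  · have h2 := norm_one_sub_zpow_le (AddCircle.toCircle (u 0)) (-b 1)
    have h3 := norm_one_sub_zpow_le (AddCircle.toCircle (u 1)) (b 0)
    simp only [Int.cast_neg, abs_neg] at h2
    have h4 := mul_le_mul_of_nonneg_left h0 (abs_nonneg (b 1 : ℝ))
    have h5 := mul_le_mul_of_nonneg_left h1 (abs_nonneg (b 0 : ℝ))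
    simp only [expI] at h4 h5
    simp only [Matrix.cons_val_zero, Matrix.cons_val_one, Matrix.cons_val_fin_one]
    linarith

section Integrals

variable {a b : Fin 2 → ℤ} (h : a 0 * b 0 + a 1 * b 1 = 1)
include h

theorem abs_add_abs_pos : 0 < |(b 0 : ℝ)| + |(b 1 : ℝ)| := by
  by_contra hcon
  have h0 : |(b 0 : ℝ)| = 0 := by linarith [abs_nonneg (b 0 : ℝ), abs_nonneg (b 1 : ℝ)]
  have h1 : |(b 1 : ℝ)| = 0 := by linarith [abs_nonneg (b 0 : ℝ), abs_nonneg (b 1 : ℝ)]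
  rw [abs_eq_zero, Int.cast_eq_zero] at h0 h1
  rw [h0, h1] at h
  simp at h

theorem inv_mul_coordDist_le (u : AngleTorus) :
    (|(b 0 : ℝ)| + |(b 1 : ℝ)|)⁻¹ * coordDist b u ≤ maxDist u := by
  rw [inv_mul_le_iff₀ (abs_add_abs_pos h)]
  exact coordDist_le b u

variable {e : ℕ} [NeZero e]

theorem ae_coordDist_ne_zero : ∀ᵐ u ∂(segmentMeasure a e), coordDist b u ≠ 0 := by
  have h1 := ae_toCircle_ne_one
  rw [← map_angleCoord_segmentMeasure h (e := e)] at h1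
  filter_upwards [ae_of_ae_map (continuous_angleCoord b).measurable.aemeasurable h1] with u hu
  rwa [coordDist_eq]

theorem integrable_log_coordDist :
    Integrable (fun u => Real.log (coordDist b u)) (segmentMeasure a e) := by
  have h1 := integrable_log_norm_one_sub_toCircle
  rw [← map_angleCoord_segmentMeasure h (e := e)] at h1
  simp only [coordDist_eq]
  exact h1.comp_measurable (continuous_angleCoord b).measurable

theorem integral_log_coordDist : ∫ u, Real.log (coordDist b u) ∂(segmentMeasure a e) = 0 := by
  have h1 := integral_log_norm_one_sub_toCircle
  have h2 := integrable_log_norm_one_sub_toCircle.aestronglyMeasurable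
  rw [← map_angleCoord_segmentMeasure h (e := e)] at h1 h2
  rw [integral_map (continuous_angleCoord b).measurable.aemeasurable h2] at h1
  simpa only [coordDist_eq] using h1

theorem integrable_logMax : Integrable logMax (segmentMeasure a e) := by
  have := isProbabilityMeasure_segmentMeasure h (e := e)
  exact integrable_log_of_le (inv_pos.mpr (abs_add_abs_pos h)) (coordDist_nonneg b)
    (inv_mul_coordDist_le h) (ae_coordDist_ne_zero h) (integrable_log_coordDist h)

/-! ### Explicit values -/

/-- For `e = 1` there is a single segment, parametrized by `t ↦ (-a₂ t, a₁ t)`. -/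
theorem eta_one_eq : eta a 1 = ∫ t : AddCircle (2 * π),
    Real.log (max ‖(AddCircle.toCircle t : ℂ) ^ a 0 - (AddCircle.toCircle t : ℂ) ^ (-a 1)‖
      (max ‖(AddCircle.toCircle t : ℂ) ^ a 0 - 1‖ ‖(AddCircle.toCircle t : ℂ) ^ (-a 1) - 1‖))
      ∂AddCircle.haarAddCircle := by
  have hm : segmentMeasure a 1 = AddCircle.haarAddCircle.map (anglePoint a b 0) := by
    have hc : ∀ j : (ZMod 1)ˣ, segmentAngle 1 j = 0 := fun j => by
      have : (j : ZMod 1).val = 0 := by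
        have := ZMod.val_lt (j : ZMod 1)
        omega
      simp [segmentAngle, this]
    have hcard : Fintype.card (ZMod 1)ˣ = 1 := by simp
    rw [segmentMeasure_eq h]
    simp only [hc, Finset.sum_const, Finset.card_univ, hcard]
    simp
  have hmeas : Measurable logMax := Real.measurable_log.comp maxDist.continuous.measurable
  rw [eta, hm, integral_map (continuous_anglePoint a b 0).measurable.aemeasurable
    hmeas.aestronglyMeasurable]
  refine integral_congr_ae (Eventually.of_forall fun t => ?_)
  simp only [logMax, expI, anglePoint, Matrix.cons_val_zero, Matrix.cons_val_one,
    Matrix.cons_val_fin_one, smul_zero, zero_sub, zero_add, AddCircle.toCircle_neg,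
    AddCircle.toCircle_zsmul, Circle.coe_inv, Circle.coe_zpow, zpow_neg]

theorem eta_eq_zero_of_max (hmax : ∀ z : Circle,
    max ‖(z : ℂ) ^ a 0 - (z : ℂ) ^ (-a 1)‖ (max ‖(z : ℂ) ^ a 0 - 1‖ ‖(z : ℂ) ^ (-a 1) - 1‖) =
      ‖1 - (z : ℂ)‖) : eta a 1 = 0 := by
  rw [eta_one_eq h]
  simp only [hmax]
  exact integral_log_norm_one_sub_toCircle

theorem eta_eq_circleAverage_of_max (hmax : ∀ z : Circle,
    max ‖(z : ℂ) ^ a 0 - (z : ℂ) ^ (-a 1)‖ (max ‖(z : ℂ) ^ a 0 - 1‖ ‖(z : ℂ) ^ (-a 1) - 1‖) =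
      ‖1 - (z : ℂ)‖ * max 1 ‖1 + (z : ℂ)‖) :
    eta a 1 = Real.circleAverage (fun z => log⁺ ‖1 + z‖) 0 1 := by
  have hcont : Continuous fun z : ℂ => log⁺ ‖1 + z‖ := Real.continuous_posLog.comp (by fun_prop)
  have hint : Integrable (fun t : AddCircle (2 * π) => log⁺ ‖1 + (AddCircle.toCircle t : ℂ)‖)
      AddCircle.haarAddCircle :=
    integrable_haarAddCircle_toCircle (F := fun z => log⁺ ‖1 + z‖)
      (hcont.continuousOn.circleIntegrable zero_le_one) hcont.measurable
  rw [eta_one_eq h, ← integral_haarAddCircle_toCircle,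
    ← zero_add (∫ t : AddCircle (2 * π), log⁺ ‖1 + (AddCircle.toCircle t : ℂ)‖ ∂_),
    ← integral_log_norm_one_sub_toCircle, ← integral_add integrable_log_norm_one_sub_toCircle hint]
  refine integral_congr_ae ?_
  filter_upwards [ae_toCircle_ne_one] with t ht
  rw [hmax, Real.log_mul ht (by positivity), Real.posLog_eq_log_max_one (norm_nonneg _)]

end Integrals

theorem norm_inv_sub_one (z : Circle) : ‖(z : ℂ)⁻¹ - 1‖ = ‖(z : ℂ) - 1‖ := by
  have hz := Circle.coe_ne_zero z
  have : (z : ℂ)⁻¹ - 1 = -((z : ℂ)⁻¹ * (z - 1)) := by field_simp; ring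
  rw [this, norm_neg, norm_mul, norm_inv, Circle.norm_coe, inv_one, one_mul]

theorem norm_sq_sub_one (z : ℂ) : ‖z ^ 2 - 1‖ = ‖z - 1‖ * ‖1 + z‖ := by
  rw [← norm_mul]; congr 1; ring

theorem norm_sq_sub_self (z : Circle) : ‖(z : ℂ) ^ 2 - z‖ = ‖(z : ℂ) - 1‖ := by
  have : (z : ℂ) ^ 2 - z = z * (z - 1) := by ring
  rw [this, norm_mul, Circle.norm_coe, one_mul]

theorem norm_self_sub_inv (z : Circle) : ‖(z : ℂ) - (z : ℂ)⁻¹‖ = ‖(z : ℂ) - 1‖ * ‖1 + (z : ℂ)‖ := by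
  have hz := Circle.coe_ne_zero z
  have : (z : ℂ) - (z : ℂ)⁻¹ = (z : ℂ)⁻¹ * (z ^ 2 - 1) := by field_simp
  rw [this, norm_mul, norm_inv, Circle.norm_coe, inv_one, one_mul, norm_sq_sub_one]

theorem eta_eq_zero : ∀ a ∈ ({![0, 1], ![1, 0], ![1, -1]} : Set (Fin 2 → ℤ)), eta a 1 = 0 := by
  rintro a (rfl | rfl | rfl)
  · refine eta_eq_zero_of_max (b := ![0, 1]) (by simp) fun z => ?_
    simp [norm_sub_rev (1 : ℂ), norm_inv_sub_one]
  · refine eta_eq_zero_of_max (b := ![1, 0]) (by simp) fun z => ?_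
    simp [norm_sub_rev (1 : ℂ)]
  · refine eta_eq_zero_of_max (b := ![1, 0]) (by simp) fun z => ?_
    simp [norm_sub_rev (1 : ℂ)]

theorem eta_eq_LFunction : ∀ a ∈ ({![2, -1], ![1, 1], ![1, -2]} : Set (Fin 2 → ℤ)),
    (eta a 1 : ℂ) =
      3 * (√3 : ℝ) / (4 * (π : ℝ)) * DirichletCharacter.LFunction chiNegThree 2 := by
  have key : ∀ x w : ℝ, 0 ≤ x → max x (max (x * w) x) = x * max 1 w := fun x w hx => by
    rw [mul_max_of_nonneg _ _ hx, mul_one, max_comm (x * w) x, ← max_assoc, max_self]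
  rintro a (rfl | rfl | rfl)
  · rw [eta_eq_circleAverage_of_max (b := ![0, -1]) (by simp), circleAverage_posLog_eq_LFunction]
    intro z
    have := key ‖(z : ℂ) - 1‖ ‖1 + (z : ℂ)‖ (norm_nonneg _)
    simpa [norm_sub_rev (1 : ℂ), norm_sq_sub_one, norm_sq_sub_self, zpow_ofNat] using this
  · rw [eta_eq_circleAverage_of_max (b := ![1, 0]) (by simp), circleAverage_posLog_eq_LFunction]
    intro z
    have := key ‖(z : ℂ) - 1‖ ‖1 + (z : ℂ)‖ (norm_nonneg _)
    rw [max_comm (_ * _), ← max_assoc, max_self, max_comm] at this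
    simpa [norm_sub_rev (1 : ℂ), norm_self_sub_inv, norm_inv_sub_one] using this
  · rw [eta_eq_circleAverage_of_max (b := ![1, 0]) (by simp), circleAverage_posLog_eq_LFunction]
    intro z
    have := key ‖(z : ℂ) - 1‖ ‖1 + (z : ℂ)‖ (norm_nonneg _)
    rw [max_comm (_ * _)] at this
    simpa [norm_sub_rev (1 : ℂ), norm_sub_rev (z : ℂ) (_ ^ 2), norm_sq_sub_one, norm_sq_sub_self,
      zpow_ofNat] using this

/-! ### The intersection point -/

/-- Homogeneous coordinates of the intersection of the line `x₀ + x₁ + x₂ = 0` with its translate by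
`γ`, namely the cross product of `(1, 1, 1)` and `(1, γ₁⁻¹, γ₂⁻¹)`. -/
noncomputable def crossVec (γ : Torus 2) : Fin 3 → QBar :=
  ![(γ 1 : QBar)⁻¹ - (γ 0 : QBar)⁻¹, 1 - (γ 1 : QBar)⁻¹, (γ 0 : QBar)⁻¹ - 1]

theorem crossVec_ne_zero {γ : Torus 2} (hγ : γ ≠ 1) : crossVec γ ≠ 0 := by
  intro h
  apply hγ
  have h1 : 1 - (γ 1 : QBar)⁻¹ = 0 := congrFun h 1
  have h2 : (γ 0 : QBar)⁻¹ - 1 = 0 := congrFun h 2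
  rw [sub_eq_zero] at h1 h2
  funext i
  apply Units.ext
  fin_cases i
  · exact inv_eq_one.mp h2
  · exact inv_eq_one.mp h1.symm

theorem mem_line_mk {v : Fin 3 → QBar} (hv : v ≠ 0) :
    Projectivization.mk QBar v hv ∈ line ↔ v 0 + v 1 + v 2 = 0 := by
  obtain ⟨c, hc⟩ := Projectivization.exists_smul_eq_mk_rep QBar v hv
  have hrep : ∀ i, (Projectivization.mk QBar v hv).rep i = c * v i := fun i => (congrFun hc i).symm
  rw [line, Set.mem_ofPred_eq, hrep, hrep, hrep, ← mul_add, ← mul_add, mul_eq_zero]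
  simp

theorem mem_translate_line_mk (γ : Torus 2) {v : Fin 3 → QBar} (hv : v ≠ 0) :
    Projectivization.mk QBar v hv ∈ translate γ '' line ↔
      v 0 + (γ 0 : QBar)⁻¹ * v 1 + (γ 1 : QBar)⁻¹ * v 2 = 0 := by
  have h0 : (γ 0 : QBar) ≠ 0 := (γ 0).ne_zero
  have h1 : (γ 1 : QBar) ≠ 0 := (γ 1).ne_zero
  constructor
  · rintro ⟨ξ, hξ, hmap⟩
    induction ξ using Projectivization.ind with
    | h w hw =>
      rw [mem_line_mk] at hξ
      rw [translate, Projectivization.map_mk, Projectivization.mk_eq_mk_iff'] at hmap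
      obtain ⟨c, hc⟩ := hmap
      have e0 : c * v 0 = 1 * w 0 := congrFun hc 0
      have e1 : c * v 1 = γ 0 * w 1 := congrFun hc 1
      have e2 : c * v 2 = γ 1 * w 2 := congrFun hc 2
      have hc0 : c ≠ 0 := by
        rintro rfl
        apply hw
        funext i
        fin_cases i
        · simpa using e0.symm
        · simpa [h0] using e1.symm
        · simpa [h1] using e2.symm
      apply (mul_eq_zero.mp _).resolve_left hc0
      have a1 := inv_mul_cancel₀ h0
      have a2 := inv_mul_cancel₀ h1
      linear_combination e0 + (γ 0 : QBar)⁻¹ * e1 + (γ 1 : QBar)⁻¹ * e2 + hξ + w 1 * a1 + w 2 * a2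
  · intro h
    have hw : ![v 0, (γ 0 : QBar)⁻¹ * v 1, (γ 1 : QBar)⁻¹ * v 2] ≠ 0 := by
      intro hz
      apply hv
      funext i
      fin_cases i
      · exact congrFun hz 0
      · simpa [h0] using congrFun hz 1
      · simpa [h1] using congrFun hz 2
    refine ⟨Projectivization.mk QBar _ hw, (mem_line_mk hw).mpr h, ?_⟩
    rw [translate, Projectivization.map_mk, Projectivization.mk_eq_mk_iff']
    refine ⟨1, ?_⟩
    rw [one_smul]
    funext i
    fin_cases i
    · simp [diagMap]
    · exact (mul_inv_cancel_left₀ h0 (v 1)).symm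
    · exact (mul_inv_cancel_left₀ h1 (v 2)).symm

/-- The translate of the line by `γ` is the line `x₀ + γ₁⁻¹ x₁ + γ₂⁻¹ x₂ = 0`, which differs from
the line itself as `γ ≠ 1`. -/
theorem line_inter_translate {γ : Torus 2} (hγ : γ ≠ 1) :
    line ∩ translate γ '' line = {Projectivization.mk QBar _ (crossVec_ne_zero hγ)} := by
  set p := (γ 0 : QBar)⁻¹ with hp
  set q := (γ 1 : QBar)⁻¹ with hq
  have hpq : p ≠ 1 ∨ q ≠ 1 := by
    by_contra! hcon
    apply crossVec_ne_zero hγ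
    funext i
    fin_cases i <;> simp [crossVec, ← hp, ← hq, hcon.1, hcon.2]
  have hc0 : crossVec γ 0 = q - p := rfl
  have hc1 : crossVec γ 1 = 1 - q := rfl
  have hc2 : crossVec γ 2 = p - 1 := rfl
  ext ξ
  rw [Set.mem_inter_iff, Set.mem_singleton_iff]
  induction ξ using Projectivization.ind with
  | h v hv =>
    rw [mem_line_mk, mem_translate_line_mk, Projectivization.mk_eq_mk_iff', ← hp, ← hq]
    constructor
    · rintro ⟨e1, e2⟩
      rcases hpq with h | h
      · have h' : p - 1 ≠ 0 := sub_ne_zero.mpr h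
        refine ⟨v 2 / (p - 1), ?_⟩
        funext i
        fin_cases i
        · simp only [Fin.zero_eta, Pi.smul_apply, hc0, smul_eq_mul]
          field_simp
          linear_combination e2 - p * e1
        · simp only [Fin.mk_one, Pi.smul_apply, hc1, smul_eq_mul]
          field_simp
          linear_combination e1 - e2
        · simp only [Fin.reduceFinMk, Pi.smul_apply, hc2, smul_eq_mul]
          field_simp
      · have h' : 1 - q ≠ 0 := sub_ne_zero.mpr h.symm
        refine ⟨v 1 / (1 - q), ?_⟩
        funext i
        fin_cases i
        · simp only [Fin.zero_eta, Pi.smul_apply, hc0, smul_eq_mul]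
          field_simp
          linear_combination q * e1 - e2
        · simp only [Fin.mk_one, Pi.smul_apply, hc1, smul_eq_mul]
          field_simp
        · simp only [Fin.reduceFinMk, Pi.smul_apply, hc2, smul_eq_mul]
          field_simp
          linear_combination e2 - e1
    · rintro ⟨c, rfl⟩
      simp only [Pi.smul_apply, hc0, hc1, hc2, smul_eq_mul]
      constructor <;> ring

/-! ### The Galois orbit of a torsion point -/

/-- The coordinates of a torsion point are roots of unity, hence units of finite order in the ring
of integers of the field which they generate. -/
theorem exists_units_of_isOfFinOrder {γ : Torus 2} (hγ : IsOfFinOrder γ) :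
    ∃ u : Fin 2 → (NumberField.RingOfIntegers (coordField fun i => (γ i : QBar)))ˣ,
      (∀ i, IsOfFinOrder (u i)) ∧
      ∀ i, (((u i : NumberField.RingOfIntegers (coordField fun i => (γ i : QBar))) :
        coordField fun i => (γ i : QBar)) : QBar) = γ i := by
  let L := coordField fun i => (γ i : QBar)
  have hex : ∀ i, ∃ u : (NumberField.RingOfIntegers L)ˣ, IsOfFinOrder u ∧
      (((u : NumberField.RingOfIntegers L) : L) : QBar) = γ i := by
    intro i
    obtain ⟨N, hN, hpow⟩ := isOfFinOrder_iff_pow_eq_one.mp hγ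
    let x : L := ⟨γ i, IntermediateField.subset_adjoin ℚ _ (Set.mem_range_self i)⟩
    have hx : x ^ N = 1 := by
      apply Subtype.ext
      have := congrArg Units.val (congrFun hpow i)
      simpa [x] using this
    have hint : IsIntegral ℤ x := by
      refine IsIntegral.of_pow hN ?_
      rw [hx]; exact isIntegral_one
    let y : NumberField.RingOfIntegers L := ⟨x, hint⟩
    have hy : y ^ N = 1 :=
      FaithfulSMul.algebraMap_injective (NumberField.RingOfIntegers L) L
        (by rw [map_pow, map_one]; exact hx)
    refine ⟨Units.ofPowEqOne y N hy hN.ne', ?_, rfl⟩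
    exact isOfFinOrder_iff_pow_eq_one.mpr ⟨N, hN, Units.ext (by simp)⟩
  choose u hu using hex
  exact ⟨u, fun i => (hu i).1, fun i => (hu i).2⟩

theorem iSup_fin_three (f : Fin 3 → ℝ) : ⨆ i, f i = max (f 0) (max (f 1) (f 2)) := by
  apply le_antisymm
  · refine ciSup_le fun i => ?_
    fin_cases i <;> simp
  · have hb := (Set.finite_range f).bddAbove
    exact max_le (le_ciSup hb 0) (max_le (le_ciSup hb 1) (le_ciSup hb 2))

/-- If the `u i` are congruent to `1` modulo an ideal, then so is every monomial in them with
integral exponents. -/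
theorem one_sub_mem_of_units {R : Type*} [CommRing R] (I : Ideal R) (u : Fin 2 → Rˣ)
    (m : Fin 2 → ℤ) (h : ∀ i, ((u i)⁻¹ : Rˣ) - (1 : R) ∈ I) :
    (((∏ i, u i ^ m i : Rˣ) : R) - 1) ∈ I := by
  rw [← Ideal.Quotient.eq_zero_iff_mem, map_sub, map_one, sub_eq_zero]
  have hu : ∀ i, Units.map (Ideal.Quotient.mk I : R →* R ⧸ I) (u i) = 1 := by
    intro i
    rw [← inv_inj, inv_one, ← map_inv]
    apply Units.ext
    have := h i
    rw [← Ideal.Quotient.eq_zero_iff_mem, map_sub, map_one, sub_eq_zero] at this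
    exact this
  have := congrArg Units.val (map_prod (Units.map (Ideal.Quotient.mk I : R →* R ⧸ I))
    (fun i => u i ^ m i) Finset.univ)
  simp only [map_zpow, hu, one_zpow, Finset.prod_const_one, Units.val_one] at this
  exact this

/-- The conjugates of a torsion point `γ`, as points of the torus of angles indexed by the complex
embeddings of a number field `L` containing the coordinates of `γ`. The average of the logarithm of
`maxDist` over them is the archimedean part of the height of the intersection point; the
nonarchimedean part is at most `0`, and it is bounded from below by that of the algebraic integer
`1 - γ₁ ^ (-b₂) γ₂ ^ b₁`, which lies in the ideal generated by the homogeneous coordinates. -/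
theorem exists_conjugates {γ : Torus 2} (L : IntermediateField ℚ QBar) [NumberField L]
    (u : Fin 2 → (NumberField.RingOfIntegers L)ˣ) (hu : ∀ i, IsOfFinOrder (u i))
    (huγ : ∀ i, (((u i : NumberField.RingOfIntegers L) : L) : QBar) = γ i) :
    ∃ x : (L →+* ℂ) → AngleTorus,
      (∀ (E : Type) [Field E] [CharZero E] (m : Fin 2 → ℤ) (n : ℕ) (g : ℂ → E), n ≠ 0 →
        IsPrimitiveRoot (character m γ : QBar) n →
          𝔼 σ, g (angleChar m (x σ)) = 𝔼 z ∈ primitiveRoots n ℂ, g z) ∧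
      (∀ (m : Fin 2 → ℤ) σ, angleChar m (x σ) = 1 → character m γ = 1) ∧
      ∀ (hγ1 : γ ≠ 1) (b : Fin 2 → ℤ), character ![-b 1, b 0] γ ≠ 1 →
        (𝔼 σ, Real.log (maxDist (x σ))) - (𝔼 σ, Real.log (coordDist b (x σ))) ≤
            height (Projectivization.mk QBar _ (crossVec_ne_zero hγ1)) ∧
          height (Projectivization.mk QBar _ (crossVec_ne_zero hγ1)) ≤
            𝔼 σ, Real.log (maxDist (x σ)) := by
  let R := NumberField.RingOfIntegers L
  have hnorm : ∀ (σ : L →+* ℂ) i, ‖σ ((u i : R) : L)‖ = 1 := by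
    intro σ i
    obtain ⟨N, hN, hpow⟩ := isOfFinOrder_iff_pow_eq_one.mp (hu i)
    have h1 : ((u i : R) : L) ^ N = 1 := by
      have := congrArg (fun v : Rˣ => ((v : R) : L)) hpow
      simpa using this
    refine (pow_eq_one_iff_of_nonneg (norm_nonneg _) hN.ne').mp ?_
    rw [← norm_pow, ← map_pow, h1, map_one, norm_one]
  have hex : ∀ σ : L →+* ℂ, ∃ x : AngleTorus,
      ∀ i, (AddCircle.toCircle (x i) : ℂ) = σ ((u i : R) : L) := by
    intro σ
    refine ⟨WithLp.toLp 2 fun i => (AddCircle.homeomorphCircle Real.two_pi_pos.ne').symm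
      ⟨σ ((u i : R) : L), mem_sphere_zero_iff_norm.mpr (hnorm σ i)⟩, fun i => ?_⟩
    have := (AddCircle.homeomorphCircle Real.two_pi_pos.ne').apply_symm_apply
      (⟨σ ((u i : R) : L), mem_sphere_zero_iff_norm.mpr (hnorm σ i)⟩ : Circle)
    rw [AddCircle.homeomorphCircle_apply] at this
    exact congrArg Subtype.val this
  choose x hx using hex
  -- values of characters at the conjugates
  have hval : ∀ m : Fin 2 → ℤ, ((((∏ i, u i ^ m i : Rˣ) : R) : L) : QBar) = character m γ := by
    intro m
    let φ : Rˣ →* QBarˣ := Units.map ((algebraMap L QBar).comp (algebraMap R L) : R →* QBar)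
    have hφ : ∀ i, φ (u i) = γ i := fun i => Units.ext (huγ i)
    have := congrArg Units.val (map_prod φ (fun i => u i ^ m i) Finset.univ)
    simp only [map_zpow, hφ] at this
    exact this
  have hchar : ∀ (m : Fin 2 → ℤ) σ,
      angleChar m (x σ) = σ (((∏ i, u i ^ m i : Rˣ) : R) : L) := by
    intro m σ
    let φ : Rˣ →* ℂˣ := Units.map (σ.comp (algebraMap R L) : R →* ℂ)
    have := congrArg Units.val (map_prod φ (fun i => u i ^ m i) Finset.univ)
    simp only [map_zpow, Fin.prod_univ_two, Units.val_mul, Units.val_zpow_eq_zpow_val] at this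
    rw [angleChar_apply, hx, hx, Fin.prod_univ_two]
    exact this.symm
  refine ⟨x, ?_, ?_, ?_⟩
  · intro E _ _ m n g hn hprim
    simp only [hchar]
    refine expect_embeddings_primitiveRoots hn ?_ g
    rw [← hval] at hprim
    exact IsPrimitiveRoot.of_map_of_injective (f := algebraMap L QBar) hprim
      (algebraMap L QBar).injective
  · intro m σ h1
    rw [hchar, map_eq_one_iff σ σ.injective] at h1
    apply Units.ext
    rw [← hval, h1]
    rfl
  · intro hγ1 b hb
    let y : Fin 3 → R := ![((u 1)⁻¹ : Rˣ) - ((u 0)⁻¹ : Rˣ), 1 - ((u 1)⁻¹ : Rˣ), ((u 0)⁻¹ : Rˣ) - 1]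
    have hinv : ∀ i, ((((u i)⁻¹ : Rˣ) : R) : L) = ((u i : R) : L)⁻¹ := by
      intro i
      apply eq_inv_of_mul_eq_one_left
      simp
    have hyL : (fun i => (((y i : R) : L) : QBar)) = crossVec γ := by
      funext i
      fin_cases i <;> simp [y, crossVec, hinv, huγ]
    have hy0 : y ≠ 0 := by
      intro h0
      apply crossVec_ne_zero hγ1
      rw [← hyL, h0]
      funext i
      simp
    have hyne : (fun i => (((y i : R) : L) : QBar)) ≠ 0 := hyL ▸ crossVec_ne_zero hγ1
    have hheight : height (Projectivization.mk QBar _ (crossVec_ne_zero hγ1)) =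
        Height.logHeight (fun i => ((y i : R) : L)) / (Module.finrank ℚ L : ℝ) := by
      rw [← height_mk L (fun i => ((y i : R) : L)) hyne]
      congr 2
      exact hyL.symm
    have hmax : ∀ σ : L →+* ℂ, ⨆ i, ‖σ (y i : R)‖ = maxDist (x σ) := by
      intro σ
      have hz : ∀ i, σ ((((u i)⁻¹ : Rˣ) : R) : L) = ((AddCircle.toCircle (x σ i) : Circle) : ℂ)⁻¹ :=
        fun i => by rw [hinv, map_inv₀, hx]
      rw [iSup_fin_three]
      have e0 : σ ((y 0 : R) : L) = ((AddCircle.toCircle (x σ 1) : Circle) : ℂ)⁻¹ -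
          ((AddCircle.toCircle (x σ 0) : Circle) : ℂ)⁻¹ := by
        rw [← hz, ← hz, ← map_sub]; rfl
      have e1 : σ ((y 1 : R) : L) = 1 - ((AddCircle.toCircle (x σ 1) : Circle) : ℂ)⁻¹ := by
        rw [← hz, ← map_one σ, ← map_sub]; rfl
      have e2 : σ ((y 2 : R) : L) = ((AddCircle.toCircle (x σ 0) : Circle) : ℂ)⁻¹ - 1 := by
        rw [← hz, ← map_one σ, ← map_sub]; rfl
      rw [e0, e1, e2, norm_sub_rev 1, norm_inv_sub_one, norm_inv_sub_one]
      have h3 : ∀ z w : Circle, ‖(z : ℂ)⁻¹ - (w : ℂ)⁻¹‖ = ‖(z : ℂ) - w‖ := by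
        intro z w
        rw [inv_sub_inv (Circle.coe_ne_zero z) (Circle.coe_ne_zero w), norm_div, norm_mul,
          Circle.norm_coe, Circle.norm_coe, mul_one, div_one, norm_sub_rev]
      rw [h3]
      rfl
    set w : R := 1 - ((∏ i, u i ^ (![-b 1, b 0] : Fin 2 → ℤ) i : Rˣ) : R) with hw
    have hcoord : ∀ σ : L →+* ℂ, ‖σ (w : R)‖ = coordDist b (x σ) := by
      intro σ
      change _ = ‖1 - angleChar ![-b 1, b 0] (x σ)‖
      rw [hchar, ← map_one σ, ← map_sub]
      rfl
    have hw0 : w ≠ 0 := by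
      rw [hw, sub_ne_zero]
      intro h1
      apply hb
      apply Units.ext
      rw [← hval, ← h1]
      rfl
    have hwmem : w ∈ Ideal.span (Set.range y) := by
      rw [hw, ← neg_sub]
      refine Ideal.neg_mem_iff _ |>.mpr (one_sub_mem_of_units _ u _ fun i => ?_)
      fin_cases i
      · exact Ideal.subset_span ⟨2, rfl⟩
      · have : (((u 1)⁻¹ : Rˣ) : R) - 1 = -(y 1) := by simp [y]
        change (((u 1)⁻¹ : Rˣ) : R) - 1 ∈ _
        rw [this]
        exact Ideal.neg_mem_iff _ |>.mpr (Ideal.subset_span ⟨1, rfl⟩)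
    rw [hheight]
    have hlow := expect_sub_le_logHeight hy0 hw0 hwmem
    have hup := logHeight_le_expect hy0
    simp only [hmax, hcoord] at hlow hup
    exact ⟨hlow, hup⟩

/-! ### Strict sequences -/

theorem character_add (m n : Fin 2 → ℤ) (γ : Torus 2) :
    character (m + n) γ = character m γ * character n γ := by
  simp only [character, Pi.add_apply, zpow_add, Finset.prod_mul_distrib]

theorem character_smul (k : ℤ) (m : Fin 2 → ℤ) (γ : Torus 2) :
    character (k • m) γ = character m γ ^ k := by
  simp only [character, Pi.smul_apply, smul_eq_mul, Finset.prod_zpow, mul_comm k, zpow_mul]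

/-- The kernel of a character, as an algebraic subgroup. -/
noncomputable def charKer (m : Fin 2 → ℤ) : Subgroup (Torus 2) where
  carrier := {γ | character m γ = 1}
  one_mem' := by simp [character]
  mul_mem' := by
    intro γ δ hγ hδ
    rw [Set.mem_ofPred_eq] at *
    rw [← one_mul (1 : QBarˣ)]
    nth_rewrite 1 [← hγ]
    rw [← hδ]
    simp only [character, Pi.mul_apply, mul_zpow, Finset.prod_mul_distrib]
  inv_mem' := by
    intro γ hγ
    rw [Set.mem_ofPred_eq] at *
    rw [← inv_one, ← hγ]
    simp only [character, Pi.inv_apply, inv_zpow, Finset.prod_inv_distrib]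

theorem isAlgebraicSet_charKer (m : Fin 2 → ℤ) :
    IsAlgebraicSet (charKer m : Set (Torus 2)) := by
  refine ⟨{∏ i, MvPolynomial.X i ^ (m i).toNat - ∏ i, MvPolynomial.X i ^ (-m i).toNat}, ?_⟩
  ext γ
  have hsplit : character m γ =
      (∏ i, γ i ^ (m i).toNat) * (∏ i, γ i ^ (-m i).toNat)⁻¹ := by
    rw [character, ← Finset.prod_inv_distrib, ← Finset.prod_mul_distrib]
    refine Finset.prod_congr rfl fun i _ => ?_
    rw [← zpow_natCast, ← zpow_natCast, ← zpow_neg, ← zpow_add]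
    congr 1
    omega
  change character m γ = 1 ↔ _
  rw [hsplit, mul_inv_eq_one, Units.ext_iff]
  simp [sub_eq_zero]

section Strict

variable {a b : Fin 2 → ℤ} (h : a 0 * b 0 + a 1 * b 1 = 1) {e : ℕ} [NeZero e]

/-- The value of `χ^a` at a point of the curve is a primitive `e`-th root of unity. -/
theorem isPrimitiveRoot_character {γ : Torus 2} (hγ : γ ∈ torsionCurve a e) :
    IsPrimitiveRoot (character a γ : QBar) e :=
  Polynomial.isRoot_cyclotomic_iff.mp hγ

include h

/-- Expansion of a character in the basis formed by `χ^a` and the character with exponent `(-b₂,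
b₁)`. -/
theorem character_eq_mul (m : Fin 2 → ℤ) (γ : Torus 2) :
    character m γ = character a γ ^ (b 0 * m 0 + b 1 * m 1) *
      character ![-b 1, b 0] γ ^ (a 0 * m 1 - a 1 * m 0) := by
  rw [← character_smul, ← character_smul, ← character_add]
  congr 1
  funext i
  fin_cases i
  · simp only [Fin.zero_eta, Pi.add_apply, Pi.smul_apply, Matrix.cons_val_zero, smul_eq_mul]
    linear_combination (-m 0) * h
  · simp only [Fin.mk_one, Pi.add_apply, Pi.smul_apply, Matrix.cons_val_one,
      Matrix.cons_val_fin_one, smul_eq_mul]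
    linear_combination (-m 1) * h

/-- As `χ^a` and the completing character form a basis of the characters, the latter takes every
value on the curve `Φ_e (χ^a) = 0`. -/
theorem exists_mem_torsionCurve (y : QBarˣ) :
    ∃ γ ∈ torsionCurve a e, character ![-b 1, b 0] γ = y := by
  obtain ⟨x, hx⟩ := IsAlgClosed.exists_root (Polynomial.cyclotomic e QBar) (by
    rw [Polynomial.degree_cyclotomic]
    exact_mod_cast (Nat.totient_pos.mpr (NeZero.pos e)).ne')
  have hx0 : x ≠ 0 := (Polynomial.isRoot_cyclotomic_iff.mp hx).ne_zero (NeZero.ne e)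
  let X : QBarˣ := Units.mk0 x hx0
  let γ : Torus 2 := ![X ^ b 0 * y ^ (-a 1), X ^ b 1 * y ^ a 0]
  have e1 : character a γ = X := by
    have : character a γ = X ^ (a 0 * b 0 + a 1 * b 1) := by
      simp only [character, Fin.prod_univ_two, γ, Matrix.cons_val_zero, Matrix.cons_val_one,
        Matrix.cons_val_fin_one]
      rw [mul_zpow, mul_zpow, ← zpow_mul, ← zpow_mul, ← zpow_mul, ← zpow_mul, mul_mul_mul_comm,
        ← zpow_add, ← zpow_add, show -a 1 * a 0 + a 0 * a 1 = 0 by ring, zpow_zero, mul_one,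
        mul_comm (b 0), mul_comm (b 1)]
    rw [this, h, zpow_one]
  have e2 : character ![-b 1, b 0] γ = y := by
    have : character ![-b 1, b 0] γ = y ^ (a 0 * b 0 + a 1 * b 1) := by
      simp only [character, Fin.prod_univ_two, γ, Matrix.cons_val_zero, Matrix.cons_val_one,
        Matrix.cons_val_fin_one]
      rw [mul_zpow, mul_zpow, ← zpow_mul, ← zpow_mul, ← zpow_mul, ← zpow_mul, mul_mul_mul_comm,
        ← zpow_add, ← zpow_add, show b 0 * -b 1 + b 1 * b 0 = 0 by ring, zpow_zero, one_mul,
        show -a 1 * -b 1 + a 0 * b 0 = a 0 * b 0 + a 1 * b 1 by ring]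
    rw [this, h, zpow_one]
  refine ⟨γ, ?_, e2⟩
  change (Polynomial.cyclotomic e QBar).eval (character a γ : QBar) = 0
  rw [e1]
  exact hx

/-- A character whose exponent is not proportional to `a` is not constantly `1` on the curve. -/
theorem not_torsionCurve_subset_charKer {m : Fin 2 → ℤ} (hm : a 0 * m 1 - a 1 * m 0 ≠ 0) :
    ¬ torsionCurve a e ⊆ (charKer m : Set (Torus 2)) := by
  intro hsub
  set s := a 0 * m 1 - a 1 * m 0
  set r := b 0 * m 0 + b 1 * m 1
  -- raising to the power `e` kills the factor coming from `χ^a`, so that `y ^ (s * e) = 1` for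
  -- every `y`, which is absurd for `y = 2`
  have hval : ∀ y : QBarˣ, y ^ (s * e) = 1 := by
    intro y
    obtain ⟨γ, hγ, hy⟩ := exists_mem_torsionCurve (e := e) h y
    have h1 : character m γ = 1 := hsub hγ
    have h2 : character a γ ^ e = 1 := Units.ext (by
      simpa using (isPrimitiveRoot_character hγ).pow_eq_one)
    have h3 := congrArg (· ^ e) h1
    simp only [one_pow, character_eq_mul h m γ, mul_pow, hy] at h3
    have h4 : (character a γ ^ r) ^ e = 1 := by
      rw [← zpow_natCast, ← zpow_mul, mul_comm, zpow_mul, zpow_natCast, h2, one_zpow]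
    rw [h4, one_mul, ← zpow_natCast, ← zpow_mul] at h3
    exact h3
  have he : (e : ℤ) ≠ 0 := by exact_mod_cast NeZero.ne e
  have h2 := congrArg Units.val (hval (Units.mk0 2 two_ne_zero))
  have h3 : ((2 : ℚ) ^ (s * e) : ℚ) = 1 := by
    apply (algebraMap ℚ QBar).injective
    simpa using h2
  have h4 := (zpow_eq_one_iff_right₀ (show (0 : ℚ) ≤ 2 by norm_num) (by norm_num)).mp h3
  exact mul_ne_zero hm he h4

/-- Along a strict sequence of torsion points, a character whose exponent is not proportional to `a`
takes values of order tending to infinity: for every `N` the sequence eventually leaves the kernel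
of the `N!`-th power of the character, which contains all points where the order is at most `N`. -/
theorem tendsto_orderOf_character {ω : ℕ → Torus 2} (hω : IsStrictIn (torsionCurve a e) ω)
    (hfin : ∀ l, IsOfFinOrder (ω l)) {m : Fin 2 → ℤ} (hm : a 0 * m 1 - a 1 * m 0 ≠ 0) :
    Tendsto (fun l => orderOf (character m (ω l))) atTop atTop := by
  rw [tendsto_atTop]
  intro N
  have hN : ((N.factorial : ℕ) : ℤ) ≠ 0 := by exact_mod_cast N.factorial_ne_zero
  have hm' : a 0 * (((N.factorial : ℕ) : ℤ) • m) 1 - a 1 * (((N.factorial : ℕ) : ℤ) • m) 0 ≠ 0 := by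
    simp only [Pi.smul_apply, smul_eq_mul]
    rw [show ∀ k : ℤ, a 0 * (k * m 1) - a 1 * (k * m 0) = k * (a 0 * m 1 - a 1 * m 0) from
      fun k => by ring]
    exact mul_ne_zero hN hm
  filter_upwards [hω.2 _ (isAlgebraicSet_charKer _) (not_torsionCurve_subset_charKer h hm')]
    with l hl
  by_contra! hlt
  apply hl
  change character _ (ω l) = 1
  rw [character_smul, zpow_natCast]
  apply orderOf_dvd_iff_pow_eq_one.mp
  refine Nat.dvd_factorial (IsOfFinOrder.orderOf_pos ?_) hlt.le
  obtain ⟨k, hk, hpow⟩ := isOfFinOrder_iff_pow_eq_one.mp (hfin l)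
  refine isOfFinOrder_iff_pow_eq_one.mpr ⟨k, hk, ?_⟩
  have hi : ∀ i, ω l i ^ k = 1 := fun i => congrFun hpow i
  simp only [character, ← Finset.prod_pow]
  refine Finset.prod_eq_one fun i _ => ?_
  rw [← zpow_natCast, ← zpow_mul, mul_comm, zpow_mul, zpow_natCast, hi, one_zpow]

/-- The heights of the intersection points along a strict sequence converge to `eta a e`. Both
bounds from `exists_conjugates` converge to this value: the averages of `log maxDist` by equidistribution,
and the averages of `log (coordDist b)` tend to `0`. -/
theorem tendsto_height {ω : ℕ → Torus 2} (hω : IsStrictIn (torsionCurve a e) ω)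
    (hfin : ∀ l, IsOfFinOrder (ω l)) (hne : ∀ l, ω l ≠ 1) :
    Tendsto (fun l => height (Projectivization.mk QBar _ (crossVec_ne_zero (hne l)))) atTop
      (𝓝 (eta a e)) := by
  choose u hu huω using fun l => exists_units_of_isOfFinOrder (hfin l)
  choose x hprim hone hheight using fun l => exists_conjugates _ (u l) (hu l) (huω l)
  have := isProbabilityMeasure_segmentMeasure h (e := e)
  have hord : ∀ m : Fin 2 → ℤ, a 0 * m 1 - a 1 * m 0 ≠ 0 →
      Tendsto (fun l => orderOf (character m (ω l))) atTop atTop :=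
    fun m hm => tendsto_orderOf_character h hω hfin hm
  have hroot : ∀ (m : Fin 2 → ℤ) l, IsPrimitiveRoot (character m (ω l) : QBar)
      (orderOf (character m (ω l))) := fun m l =>
    IsPrimitiveRoot.coe_units_iff.mpr
      (IsPrimitiveRoot.orderOf (character m (ω l)))
  -- Averages of characters: those which are powers of `χ^a` on the fibres have constant averages,
  -- all others take values of order tending to infinity.
  have hweyl : ∀ f ∈ Set.range angleChar, Tendsto (fun l => 𝔼 σ, f (x l σ)) atTop
      (𝓝 (∫ u, f u ∂(segmentMeasure a e))) := by
    rintro _ ⟨m, rfl⟩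
    rw [integral_angleChar h]
    split_ifs with hm
    · apply tendsto_const_nhds.congr
      intro l
      set r := b 0 * m 0 + b 1 * m 1
      have hmr : ∀ u, angleChar m u = angleChar a u ^ r := by
        intro u
        have h0 : m 0 = a 0 * r := by linear_combination (-m 0) * h - b 1 * hm
        have h1 : m 1 = a 1 * r := by linear_combination (-m 1) * h + b 0 * hm
        rw [angleChar_apply, angleChar_apply, mul_zpow, ← zpow_mul, ← zpow_mul, ← h0, ← h1]
      simp only [hmr]
      exact (hprim l ℂ a e (fun z => z ^ r) (NeZero.ne e)
        (isPrimitiveRoot_character (hω.1 l))).symm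
    · have hφ : Tendsto (fun l => ((orderOf (character m (ω l))).totient : ℝ)⁻¹) atTop (𝓝 0) :=
        (tendsto_natCast_atTop_atTop.comp (tendsto_totient.comp (hord m hm))).inv_tendsto_atTop
      refine squeeze_zero_norm' ?_ hφ
      filter_upwards [(hord m hm).eventually_ge_atTop 1] with l hl
      have := hprim l ℂ m _ id (by omega) (hroot m l)
      simp only [id] at this
      rw [this]
      exact norm_expect_primitiveRoots_le _ hl
  have hcont := tendsto_expect_real (tendsto_expect_of_dense span_angleChar_topologicalClosure hweyl)
  -- the completing character, along which the singularity is controlled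
  have hb : a 0 * (![-b 1, b 0] : Fin 2 → ℤ) 1 - a 1 * (![-b 1, b 0] : Fin 2 → ℤ) 0 ≠ 0 := by
    simp [h]
  have hordb := hord _ hb
  have hlim : Tendsto (fun l => 𝔼 σ, Real.log (coordDist b (x l σ))) atTop (𝓝 0) := by
    have hev := hordb.eventually_gt_atTop 1
    have hval : ∀ᶠ l in atTop, 𝔼 σ, Real.log (coordDist b (x l σ)) =
        𝔼 z ∈ primitiveRoots (orderOf (character ![-b 1, b 0] (ω l))) ℂ, Real.log ‖1 - z‖ := by
      filter_upwards [hev] with l hl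
      exact hprim l ℝ _ _ (fun z => Real.log ‖1 - z‖) (by omega) (hroot _ l)
    refine squeeze_zero' ?_ ?_ (tendsto_log_div_totient.comp hordb)
    · filter_upwards [hev, hval] with l hl hv
      rw [hv]; exact (expect_log_norm_one_sub_primitiveRoots hl).1
    · filter_upwards [hev, hval] with l hl hv
      rw [hv]; exact (expect_log_norm_one_sub_primitiveRoots hl).2
  have hchar1 : ∀ᶠ l in atTop, character ![-b 1, b 0] (ω l) ≠ 1 := by
    filter_upwards [hordb.eventually_gt_atTop 1] with l hl h1
    rw [h1, orderOf_one] at hl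
    omega
  have hM : Tendsto (fun l => 𝔼 σ, Real.log (maxDist (x l σ))) atTop (𝓝 (eta a e)) := by
    refine tendsto_expect_log hcont (inv_pos.mpr (abs_add_abs_pos h)) (coordDist_nonneg b)
      (inv_mul_coordDist_le h) (ae_coordDist_ne_zero h) (integrable_log_coordDist h) ?_ ?_
    · filter_upwards [hchar1] with l hl σ h0
      apply hl
      apply hone l _ σ
      have h0' : ‖1 - angleChar ![-b 1, b 0] (x l σ)‖ = 0 := h0
      rw [norm_eq_zero, sub_eq_zero] at h0'
      exact h0'.symm
    · rw [integral_log_coordDist h]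
      exact hlim
  have hlow := hM.sub hlim
  rw [sub_zero] at hlow
  refine tendsto_of_tendsto_of_tendsto_of_le_of_le' hlow hM ?_ ?_
  · filter_upwards [hchar1] with l hl
    exact (hheight l (hne l) b hl).1
  · filter_upwards [hchar1] with l hl
    exact (hheight l (hne l) b hl).2

end Strict

end TorusHeight

theorem theorem6p4 :
    (∀ (a : Fin 2 → ℤ) (e : ℕ), Int.gcd (a 0) (a 1) = 1 → 1 ≤ e →
      Integrable logMax (segmentMeasure a e) ∧
      ∀ ω : ℕ → Torus 2, IsStrictIn (torsionCurve a e) ω →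
        (∀ l, IsOfFinOrder (ω l)) → (∀ l, ω l ≠ 1) →
        ∃ P : ℕ → Proj 2, (∀ l, line ∩ translate (ω l) '' line = {P l}) ∧
          Tendsto (fun l => height (P l)) atTop (𝓝 (eta a e))) ∧
    (∀ a ∈ ({![0, 1], ![1, 0], ![1, -1]} : Set (Fin 2 → ℤ)), eta a 1 = 0) ∧
    (∀ a ∈ ({![2, -1], ![1, 1], ![1, -2]} : Set (Fin 2 → ℤ)),
      (eta a 1 : ℂ) =
        3 * (√3 : ℝ) / (4 * (π : ℝ)) * DirichletCharacter.LFunction chiNegThree 2) := by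
  refine ⟨fun a e ha he => ?_, eta_eq_zero, eta_eq_LFunction⟩
  have : NeZero e := ⟨by omega⟩
  have h : a 0 * (![Int.gcdA (a 0) (a 1), Int.gcdB (a 0) (a 1)] : Fin 2 → ℤ) 0 +
      a 1 * (![Int.gcdA (a 0) (a 1), Int.gcdB (a 0) (a 1)] : Fin 2 → ℤ) 1 = 1 := by
    have := Int.gcd_eq_gcd_ab (a 0) (a 1)
    rw [ha] at this
    exact_mod_cast this.symm
  exact ⟨integrable_logMax h, fun ω hω hfin hne =>
    ⟨fun l => Projectivization.mk QBar _ (crossVec_ne_zero (hne l)),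
      fun l => line_inter_translate (hne l), tendsto_height h hω hfin hne⟩⟩
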